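/- Let $\mathcal H$ be a complex Hilbert space and $\mathcal L(\mathcal H)$ the bounded operators on it. A POVM $E$ with outcome space $(\Omega,\mathscr B)$ is a map $E:\mathscr B\to\mathcal L(\mathcal H)$ with $E(B)\ge 0$, $E(\Omega)=1$, that is countably additive in the weak operator topology. A CP instrument $\mathcal I$ with outcome space $(\Omega,\mathscr B)$ assigns to each $B\in\mathscr B$ a normal completely positive linear map $\mathcal I_B:\mathcal L(\mathcal H)\to\mathcal L(\mathcal H)$ such that $\mathcal I_\Omega(1)=1$ and, for every $a\in\mathcal L(\mathcal H)$, $B\mapsto\mathcal I_B(a)$ is countably additive in the ultraweak topology. For POVMs $E^1,E^2$ with outcome spaces $(\Omega_1,\mathscr B_1)$, $(\Omega_2,\mathscr B_2)$ write $E^1\preceq E^2$ if there is a Markov kernel $\nu$ from $\Omega_2$ to $\Omega_1$ with $E^1(B)=\int_{\Omega_2}\nu_\omega(B)\,E^2(d\omega)$ for all $B\in\mathscr B_1$, and $E^1\simeq E^2$ if $E^1\preceq E^2$ and $E^2\preceq E^1$. For a CP instrument $\mathcal I$ on $\Omega$ and a POVM $E$ on $\Omega_X$, both outcome spaces being standard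 Borel, the composition $\mathcal I\ast E$ is the POVM on $\Omega\times\Omega_X$ with $(\mathcal I\ast E)(B_1\times B_2)=\mathcal I_{B_1}(E(B_2))$ for all measurable $B_1,B_2$; $\mathcal I$ conserves $E$ if $\mathcal I\ast E\simeq E$. Theorem. Let $\mathcal I$ be a CP instrument with a standard Borel outcome space $(\Omega,\mathscr B)$. There is exactly one POVM $E_\infty$ on the space of sequences $\Omega^{\infty}=\Omega^{\{1,2,\dots\}}$ (with the product $\sigma$-algebra), called the infinite composition of $\mathcal I$, such that $$E_\infty(B_1\times\cdots\times B_n\times\Omega\times\Omega\times\cdots)=\mathcal I_{B_1}\circ\cdots\circ\mathcal I_{B_n}(1)\qquad(n\ge 1,\ B_1,\dots,B_n\in\mathscr B).$$ Moreover, $\mathcal I$ conserves $E_\infty$, i.e. $\mathcal I\ast E_\infty\simeq E_\infty$, and $E_\infty$ is the least element with respect to $\preceq$ among the standard Borel POVMs conserved by $\mathcal I$: for every POVM $F$ with a standard Borel outcome space that is conserved by $\mathcal I$, $E_\infty\preceq F$. -/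

import Mathlib

open MeasureTheory ProbabilityTheory
open scoped CStarAlgebra

universe u v w

noncomputable section

variable {H : Type u} [NormedAddCommGroup H] [InnerProductSpace ℂ H] [CompleteSpace H]

/-- A positive-operator valued measure on the Hilbert space `H` with outcome space `Ω`.
Only the values on measurable sets matter; as for `MeasureTheory.VectorMeasure`, the value on a
non-measurable set is `0` by convention. Positivity refers to the Loewner order of `H →L[ℂ] H`,
and the series converges in the weak operator topology. -/
@[ext]
structure POVM (H : Type u) [NormedAddCommGroup H] [InnerProductSpace ℂ H] [CompleteSpace H]
    (Ω : Type v) [MeasurableSpace Ω] where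
  /-- the operator (effect) attached to an event -/
  effect : Set Ω → (H →L[ℂ] H)
  effect_nonneg : ∀ B, MeasurableSet B → 0 ≤ effect B
  effect_univ : effect Set.univ = 1
  effect_iUnion : ∀ B : ℕ → Set Ω, (∀ i, MeasurableSet (B i)) →
    Pairwise (Function.onFun Disjoint B) →
    HasSum (fun i => (ContinuousLinearMapWOT.ofCLM (effect (B i)) : H →WOT[ℂ] H))
      (ContinuousLinearMapWOT.ofCLM (effect (⋃ i, B i)))
  effect_not_measurable : ∀ B, ¬ MeasurableSet B → effect B = 0

namespace POVM

variable {Ω : Type v} [MeasurableSpace Ω] (E : POVM H Ω)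

theorem hasSum_inner (x : H) (B : ℕ → Set Ω) (hB : ∀ i, MeasurableSet (B i))
    (hd : Pairwise (Function.onFun Disjoint B)) :
    HasSum (fun i => inner ℂ x (E.effect (B i) x)) (inner ℂ x (E.effect (⋃ i, B i) x)) := by
  have h := E.effect_iUnion B hB hd
  have hc : Continuous fun A : H →WOT[ℂ] H => inner ℂ x (A x) :=
    ContinuousLinearMapWOT.continuous_dual_apply (σ := RingHom.id ℂ) x (innerSL ℂ x)
  let f : (H →WOT[ℂ] H) →+ ℂ :=
    { toFun := fun A => inner ℂ x (A x)
      map_zero' := by simp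
      map_add' := by intro A A'; simp }
  exact h.map f hc

theorem effect_empty : E.effect ∅ = 0 := by
  have h := E.effect_iUnion (fun _ => ∅) (fun _ => MeasurableSet.empty)
    (fun i j _ => by simp [Function.onFun])
  have h0 := h.summable.tendsto_atTop_zero
  have h1 := tendsto_nhds_unique h0 tendsto_const_nhds
  exact congrArg ContinuousLinearMapWOT.toCLM h1.symm

theorem re_inner_nonneg (x : H) (B : Set Ω) (hB : MeasurableSet B) :
    0 ≤ (inner ℂ x (E.effect B x)).re :=
  ((ContinuousLinearMap.nonneg_iff_isPositive _).1 (E.effect_nonneg B hB)).re_inner_nonneg_right x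

/-- The finite measure `B ↦ ⟪x, E(B) x⟫` on the outcome space; for a unit vector `x` it is the
outcome distribution in the pure state `x`. -/
def vectorMeasure (x : H) : Measure Ω :=
  Measure.ofMeasurable (fun B _ => ENNReal.ofReal (inner ℂ x (E.effect B x)).re)
    (by simp [effect_empty])
    (by
      intro B hB hd
      have h := Complex.hasSum_re (E.hasSum_inner x B hB hd)
      rw [← h.tsum_eq]
      exact ENNReal.ofReal_tsum_of_nonneg (fun i => E.re_inner_nonneg x (B i) (hB i)) h.summable)

theorem vectorMeasure_apply (x : H) {B : Set Ω} (hB : MeasurableSet B) :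
    E.vectorMeasure x B = ENNReal.ofReal (inner ℂ x (E.effect B x)).re :=
  Measure.ofMeasurable_apply B hB

/-- `E.HasIntegral f T` says that `T` is the weak operator integral `∫ f(ω) E(dω)`: the bounded
operator `T` with `⟪x, T x⟫ = ∫ f(ω) ⟪x, E(dω) x⟫` for all `x` (unique, by polarization). -/
def HasIntegral (f : Ω → ℝ) (T : H →L[ℂ] H) : Prop :=
  ∀ x : H, Integrable f (E.vectorMeasure x) ∧
    inner ℂ x (T x) = ((∫ ω, f ω ∂(E.vectorMeasure x) : ℝ) : ℂ)

end POVM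

/-- The fuzzy preorder `E₁ ⪯ E₂` ("`E₁` is fuzzier than `E₂`"): there is a Markov kernel `ν` from
the outcome space of `E₂` to that of `E₁` with `E₁(B) = ∫ ν_ω(B) E₂(dω)` for every event `B`. -/
def FuzzyLE {Ω₁ : Type v} {Ω₂ : Type w} [MeasurableSpace Ω₁] [MeasurableSpace Ω₂]
    (E₁ : POVM H Ω₁) (E₂ : POVM H Ω₂) : Prop :=
  ∃ ν : Kernel Ω₂ Ω₁, IsMarkovKernel ν ∧
    ∀ B, MeasurableSet B → E₂.HasIntegral (fun ω => (ν ω).real B) (E₁.effect B)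

/-- Fuzzy equivalence `E₁ ≃ E₂` of POVMs. -/
def FuzzyEquiv {Ω₁ : Type v} {Ω₂ : Type w} [MeasurableSpace Ω₁] [MeasurableSpace Ω₂]
    (E₁ : POVM H Ω₁) (E₂ : POVM H Ω₂) : Prop :=
  FuzzyLE E₁ E₂ ∧ FuzzyLE E₂ E₁

/-- The series `∑ T i` converges to `T` in the ultraweak topology, the topology generated by the
functionals `A ↦ ∑ₖ ⟪x k, A (y k)⟫` with `∑ₖ ‖x k‖² < ∞` and `∑ₖ ‖y k‖² < ∞`. -/
def HasUltraweakSum (T : ℕ → (H →L[ℂ] H)) (S : H →L[ℂ] H) : Prop :=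
  ∀ x y : ℕ → H, Summable (fun k => ‖x k‖ ^ 2) → Summable (fun k => ‖y k‖ ^ 2) →
    HasSum (fun i => ∑' k, inner ℂ (x k) (T i (y k))) (∑' k, inner ℂ (x k) (S (y k)))

/-- A completely positive instrument on `H` (Heisenberg picture) with outcome space `Ω`.
The maps are linear and completely positive (`→CP`); normality of a positive map is expressed by
Scott continuity: it preserves suprema of upward directed sets of operators in the Loewner order.
Nothing is required of the map attached to a non-measurable set, and it is never used. -/
structure CPInstrument (H : Type u) [NormedAddCommGroup H] [InnerProductSpace ℂ H]
    [CompleteSpace H] (Ω : Type v) [MeasurableSpace Ω] where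
  /-- the Heisenberg-picture operation attached to an event -/
  op : Set Ω → ((H →L[ℂ] H) →CP (H →L[ℂ] H))
  op_normal : ∀ B, MeasurableSet B → ScottContinuous (op B)
  op_iUnion : ∀ B : ℕ → Set Ω, (∀ i, MeasurableSet (B i)) →
    Pairwise (Function.onFun Disjoint B) →
    ∀ a : H →L[ℂ] H, HasUltraweakSum (fun i => op (B i) a) (op (⋃ i, B i) a)
  op_univ_one : op Set.univ 1 = 1

namespace CPInstrument

variable {Ω : Type v} [MeasurableSpace Ω] (I : CPInstrument H Ω)

/-- `G` is the composition `I ∗ E` (measure `I`, then `E`): the POVM on the product space with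
`G(B₁ × B₂) = I_{B₁}(E(B₂))`. -/
def IsComposition {X : Type w} [MeasurableSpace X] (E : POVM H X) (G : POVM H (Ω × X)) : Prop :=
  ∀ B₁ B₂, MeasurableSet B₁ → MeasurableSet B₂ →
    G.effect (B₁ ×ˢ B₂) = I.op B₁ (E.effect B₂)

/-- `I` conserves `E`: the composition `I ∗ E` is fuzzy equivalent to `E`. -/
def Conserves {X : Type w} [MeasurableSpace X] (E : POVM H X) : Prop :=
  ∃ G : POVM H (Ω × X), I.IsComposition E G ∧ FuzzyEquiv G E

/-- The composed operation `I_{B₁} ∘ ⋯ ∘ I_{Bₙ}` of a list `[B₁, …, Bₙ]` of events. -/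
def opSeq : List (Set Ω) → (H →L[ℂ] H) → (H →L[ℂ] H)
  | [], a => a
  | B :: Bs, a => I.op B (opSeq Bs a)

/-- `E` is the infinite composition of `I`: the POVM on the space of outcome sequences with
`E(B₁ × ⋯ × Bₙ × Ω × Ω × ⋯) = (I_{B₁} ∘ ⋯ ∘ I_{Bₙ})(1)` for all `n ≥ 1` and events
`B₁, …, Bₙ`. -/
def IsInfiniteComposition (E : POVM H (ℕ → Ω)) : Prop :=
  ∀ n : ℕ, 1 ≤ n → ∀ B : Fin n → Set Ω, (∀ i, MeasurableSet (B i)) →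
    E.effect {ω | ∀ i : Fin n, ω i ∈ B i} = I.opSeq (List.ofFn B) 1

end CPInstrument

end

/-!
The operators `E(B)` are handled through their quadratic forms `x ↦ ⟪x, E(B) x⟫`: a POVM is the same
thing as a family of measures `⟪x, E(·) x⟫` of mass `‖x‖²` whose values are quadratic forms of
operators. Two facts about operators are used, both along increasing sequences only: a bounded
increasing sequence converges strongly (`ContinuousLinearMap.exists_tendsto_of_monotone`), and a
normal positive map is continuous along it
(`ContinuousLinearMap.tendsto_quadForm_map_of_scottContinuous`). Hence no separability of `H` is
needed.

*Existence.* For fixed `x`, the function `(B₁, …, Bₙ) ↦ ⟪x, I_{B₁} ∘ ⋯ ∘ I_{Bₙ}(1) x⟫` is a finite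
measure in each `Bᵢ` separately, by normality, and it is consistent in `n` since `I_Ω(1) = 1`. Such
a multimeasure extends to a measure on `Ω^ℕ` (`IsMultimeasure.exists_measure_box`). Indeed, coding
the points of the standard Borel space `Ω` by binary sequences turns it into an additive function of
the cylinders of the Cantor space, which extends by compactness (`exists_measure_cylinder`); replacing
one side of a box after the other, the resulting measure has the right values on all measurable
boxes, and it lives on the codes of sequences in `Ω`. The sets whose measures are quadratic forms of
an operator form a λ-system containing the boxes, so these measures come from a POVM
(`exists_povm_of_measures`). Uniqueness holds because the boxes form a generating π-system.

*Conservation.* Splitting off the first term identifies `Ω^ℕ` with `Ω × Ω^ℕ` and `E_∞` with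
`I ∗ E_∞` (`CPInstrument.conserves_of_isInfiniteComposition`).

*Minimality.* Let `ν` be a Markov kernel producing `I ∗ F` from `F`. Starting at a point of the
outcome space `X` of `F`, iterate `ν` to get a Markov chain `(ω₀, x₀), (ω₁, x₁), …` in `Ω × X`
(Ionescu-Tulcea). Since `I_C(∫ g dF) = ∫ 1_C(ω) g(x) (I ∗ F)(dω, dx)`
(`CPInstrument.isLIntegral_op`), an induction on the number of steps shows that integrating the law
of `(ω₀, ω₁, …)` against `F` gives the infinite composition (`CPInstrument.isLIntegral_opBox`).
-/

set_option linter.unusedSectionVars false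

open Filter Topology Function ContinuousLinearMap

noncomputable section

variable {H : Type u} [NormedAddCommGroup H] [InnerProductSpace ℂ H] [CompleteSpace H]

/-! ### Positive operators and their quadratic forms -/

namespace ContinuousLinearMap

/-- The quadratic form `x ↦ ⟪x, T x⟫` of an operator, with values in `[0, ∞]` (truncated below at
`0`; it is used for positive `T`, where nothing is lost). -/
def quadForm (T : H →L[ℂ] H) (x : H) : ENNReal := ENNReal.ofReal (inner ℂ x (T x)).re

theorem quadForm_ne_top (T : H →L[ℂ] H) (x : H) : T.quadForm x ≠ ⊤ := ENNReal.ofReal_ne_top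

theorem inner_self_eq_quadForm {T : H →L[ℂ] H} (hT : 0 ≤ T) (x : H) :
    inner ℂ x (T x) = (((T.quadForm x).toReal : ℝ) : ℂ) := by
  have h := ((nonneg_iff_isPositive _).1 hT).inner_nonneg_right x
  rw [Complex.nonneg_iff] at h
  rw [quadForm, ENNReal.toReal_ofReal h.1]
  exact Complex.ext rfl (by simp [← h.2])

theorem nonneg_of_inner_self_eq {T : H →L[ℂ] H} {r : H → ℝ} (hr : ∀ x, 0 ≤ r x)
    (h : ∀ x, inner ℂ x (T x) = (r x : ℂ)) : 0 ≤ T := by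
  rw [nonneg_iff_isPositive, isPositive_iff_complex]
  intro x
  have : inner ℂ (T x) x = (r x : ℂ) := by
    rw [← inner_conj_symm, h, Complex.conj_ofReal]
  rw [this]
  exact ⟨by simp, by simpa using hr x⟩

theorem eq_of_inner_self_eq {S T : H →L[ℂ] H}
    (h : ∀ x, inner ℂ x (S x) = inner ℂ x (T x)) : S = T := by
  have : (S : H →ₗ[ℂ] H) = T := by
    rw [← ext_inner_map]
    intro x
    have := congrArg (starRingEnd ℂ) (h x)
    simpa using this
  exact coe_injective this

theorem eq_of_quadForm_eq {S T : H →L[ℂ] H} (hS : 0 ≤ S) (hT : 0 ≤ T)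
    (h : ∀ x, S.quadForm x = T.quadForm x) : S = T :=
  eq_of_inner_self_eq fun x => by rw [inner_self_eq_quadForm hS, inner_self_eq_quadForm hT, h]

theorem quadForm_add {S T : H →L[ℂ] H} (hS : 0 ≤ S) (hT : 0 ≤ T) (x : H) :
    (S + T).quadForm x = S.quadForm x + T.quadForm x := by
  rw [quadForm, quadForm, quadForm, ← ENNReal.ofReal_add, add_apply, inner_add_right,
    Complex.add_re]
  · exact ((nonneg_iff_isPositive _).1 hS).re_inner_nonneg_right x
  · exact ((nonneg_iff_isPositive _).1 hT).re_inner_nonneg_right x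

@[simp] theorem quadForm_zero (x : H) : (0 : H →L[ℂ] H).quadForm x = 0 := by simp [quadForm]

theorem quadForm_sum {ι : Type*} (s : Finset ι) {T : ι → H →L[ℂ] H} (hT : ∀ i ∈ s, 0 ≤ T i)
    (x : H) : (∑ i ∈ s, T i).quadForm x = ∑ i ∈ s, (T i).quadForm x := by
  classical
  induction s using Finset.induction_on with
  | empty => simp
  | insert a s ha ih =>
    have hs : ∀ i ∈ s, 0 ≤ T i := fun i hi => hT i (Finset.mem_insert_of_mem hi)
    rw [Finset.sum_insert ha, Finset.sum_insert ha,
      quadForm_add (hT a (Finset.mem_insert_self _ _)) (Finset.sum_nonneg hs), ih hs]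

theorem quadForm_smul {r : ℝ} (hr : 0 ≤ r) (T : H →L[ℂ] H) (x : H) :
    ((r : ℂ) • T).quadForm x = ENNReal.ofReal r * T.quadForm x := by
  rw [quadForm, quadForm, ← ENNReal.ofReal_mul hr, smul_apply, inner_smul_right,
    Complex.re_ofReal_mul]

theorem smul_nonneg_of_nonneg {r : ℝ} (hr : 0 ≤ r) {T : H →L[ℂ] H} (hT : 0 ≤ T) :
    0 ≤ (r : ℂ) • T := by
  rw [nonneg_iff_isPositive] at *
  exact hT.smul_of_nonneg (by exact_mod_cast hr)

theorem quadForm_mono {S T : H →L[ℂ] H} (h : S ≤ T) (x : H) : S.quadForm x ≤ T.quadForm x := by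
  apply ENNReal.ofReal_le_ofReal
  have := ((le_def _ _).1 h).re_inner_nonneg_right x
  simp only [sub_apply, inner_sub_right, map_sub] at this
  simpa using this

theorem le_of_quadForm_le {S T : H →L[ℂ] H} (hS : 0 ≤ S) (hT : 0 ≤ T)
    (h : ∀ x, S.quadForm x ≤ T.quadForm x) : S ≤ T := by
  rw [← sub_nonneg]
  refine nonneg_of_inner_self_eq (r := fun x => (T.quadForm x).toReal - (S.quadForm x).toReal)
    (fun x => sub_nonneg.2 (ENNReal.toReal_mono (quadForm_ne_top _ _) (h x))) fun x => ?_
  rw [sub_apply, inner_sub_right, inner_self_eq_quadForm hS, inner_self_eq_quadForm hT]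
  simp

theorem tendsto_quadForm {A : ℕ → H →L[ℂ] H} {T : H →L[ℂ] H}
    (h : ∀ x, Tendsto (fun n => A n x) atTop (𝓝 (T x))) (x : H) :
    Tendsto (fun n => (A n).quadForm x) atTop (𝓝 (T.quadForm x)) :=
  ENNReal.tendsto_ofReal ((Complex.continuous_re.tendsto _).comp (tendsto_const_nhds.inner (h x)))

theorem norm_apply_sq_le {P : H →L[ℂ] H} (hP : 0 ≤ P) (x : H) :
    ‖P x‖ ^ 2 ≤ ‖P‖ * (inner ℂ x (P x)).re := by
  obtain ⟨S, hS⟩ := CStarAlgebra.nonneg_iff_eq_star_mul_self.1 hP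
  have h1 : P x = adjoint S (S x) := by rw [hS]; rfl
  have h2 : (inner ℂ x (P x)).re = ‖S x‖ ^ 2 := by
    rw [h1, adjoint_inner_right]
    exact inner_self_eq_norm_sq (𝕜 := ℂ) (S x)
  have h3 : ‖P‖ = ‖S‖ ^ 2 := by rw [hS, CStarRing.norm_star_mul_self, sq]
  rw [h2, h3, h1, ← mul_pow]
  gcongr
  calc ‖adjoint S (S x)‖ ≤ ‖adjoint S‖ * ‖S x‖ := le_opNorm _ _
    _ = ‖S‖ * ‖S x‖ := by rw [← star_eq_adjoint, norm_star]

/-- Vigier's theorem for sequences: a bounded increasing sequence of positive operators converges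
strongly. The differences satisfy `‖(A m - A n) x‖² ≤ ‖A m - A n‖ ⟪x, (A m - A n) x⟫`, and the
increasing bounded sequence `⟪x, A n x⟫` converges. -/
theorem exists_tendsto_of_monotone {A : ℕ → H →L[ℂ] H} {C : H →L[ℂ] H} (h0 : ∀ n, 0 ≤ A n)
    (hm : Monotone A) (hC : ∀ n, A n ≤ C) :
    ∃ T : H →L[ℂ] H, ∀ x, Tendsto (fun n => A n x) atTop (𝓝 (T x)) := by
  have hcau : ∀ x, CauchySeq fun n => A n x := by
    intro x
    have hq : Monotone fun n => (inner ℂ x (A n x)).re := by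
      intro m n hmn
      have := ((le_def _ _).1 (hm hmn)).re_inner_nonneg_right x
      simp only [sub_apply, inner_sub_right, map_sub] at this
      simpa using this
    have hbd : BddAbove (Set.range fun n => (inner ℂ x (A n x)).re) := by
      refine ⟨(inner ℂ x (C x)).re, ?_⟩
      rintro _ ⟨n, rfl⟩
      have := ((le_def _ _).1 (hC n)).re_inner_nonneg_right x
      simp only [sub_apply, inner_sub_right, map_sub] at this
      simpa using this
    have hc := (tendsto_atTop_ciSup hq hbd).cauchySeq
    rw [Metric.cauchySeq_iff'] at hc ⊢
    intro ε hε
    obtain ⟨N, hN⟩ := hc (ε ^ 2 / (‖C‖ + 1)) (by positivity)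
    refine ⟨N, fun n hn => ?_⟩
    have hP : 0 ≤ A n - A N := sub_nonneg.2 (hm hn)
    have hPC : ‖A n - A N‖ ≤ ‖C‖ :=
      CStarAlgebra.norm_le_norm_of_nonneg_of_le hP
        ((sub_le_self _ (h0 N)).trans (hC n))
    have h1 := norm_apply_sq_le hP x
    have h2 := hN n hn
    have h3 : (inner ℂ x ((A n - A N) x)).re < ε ^ 2 / (‖C‖ + 1) := by
      rw [sub_apply, inner_sub_right, Complex.sub_re]
      exact (le_abs_self _).trans_lt h2
    have h4 : 0 ≤ (inner ℂ x ((A n - A N) x)).re :=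
      ((nonneg_iff_isPositive _).1 hP).re_inner_nonneg_right x
    rw [dist_eq_norm, ← sub_apply]
    refine lt_of_pow_lt_pow_left₀ 2 hε.le (h1.trans_lt ?_)
    rw [lt_div_iff₀ (by positivity)] at h3
    nlinarith [norm_nonneg C]
  choose f hf using fun x => cauchySeq_tendsto_of_complete (hcau x)
  exact ⟨continuousLinearMapOfTendsto A (tendsto_pi_nhds.2 hf), hf⟩

theorem nonneg_of_tendsto {A : ℕ → H →L[ℂ] H} {T : H →L[ℂ] H} (h0 : ∀ n, 0 ≤ A n)
    (h : ∀ x, Tendsto (fun n => A n x) atTop (𝓝 (T x))) : 0 ≤ T := by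
  refine nonneg_of_inner_self_eq (r := fun x => (T.quadForm x).toReal)
    (fun x => ENNReal.toReal_nonneg) fun x => ?_
  refine tendsto_nhds_unique (tendsto_const_nhds.inner (h x)) ?_
  simp only [fun n => inner_self_eq_quadForm (h0 n) x]
  exact (Complex.continuous_ofReal.tendsto _).comp
    ((ENNReal.tendsto_toReal (quadForm_ne_top _ _)).comp (tendsto_quadForm h x))

/-- A normal positive map is continuous, in the sense of quadratic forms, along increasing sequences
of positive operators. By Scott continuity `φ A` is the supremum of the `φ (A n)`; it therefore
equals their strong limit. -/
theorem tendsto_quadForm_map_of_scottContinuous {φ : (H →L[ℂ] H) → (H →L[ℂ] H)}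
    (hφ : ScottContinuous φ) (hφ0 : ∀ T, 0 ≤ T → 0 ≤ φ T) {A : ℕ → H →L[ℂ] H} {T : H →L[ℂ] H}
    (h0 : ∀ n, 0 ≤ A n) (hm : Monotone A) (hT : 0 ≤ T)
    (h : ∀ x, Tendsto (fun n => (A n).quadForm x) atTop (𝓝 (T.quadForm x))) (x : H) :
    Tendsto (fun n => (φ (A n)).quadForm x) atTop (𝓝 ((φ T).quadForm x)) := by
  have hle : ∀ n, A n ≤ T := fun n => le_of_quadForm_le (h0 n) hT fun x =>
    Monotone.ge_of_tendsto (f := fun n => (A n).quadForm x)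
      (fun m n hmn => quadForm_mono (hm hmn) x) (h x) n
  have hlub : IsLUB (Set.range A) T := by
    refine ⟨by rintro _ ⟨n, rfl⟩; exact hle n, fun S hS => ?_⟩
    have hS' : ∀ n, A n ≤ S := fun n => hS ⟨n, rfl⟩
    exact le_of_quadForm_le hT ((h0 0).trans (hS' 0)) fun x =>
      le_of_tendsto' (h x) fun n => quadForm_mono (hS' n) x
  have hlub' := hφ (Set.range_nonempty A) (directedOn_range.2 hm.directed_le) hlub
  have hφm : Monotone φ := hφ.monotone
  obtain ⟨S, hS⟩ := exists_tendsto_of_monotone (A := fun n => φ (A n)) (C := φ T)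
    (fun n => hφ0 _ (h0 n)) (hφm.comp hm) (fun n => hφm (hle n))
  have hS0 : 0 ≤ S := nonneg_of_tendsto (fun n => hφ0 _ (h0 n)) hS
  have : S = φ T := by
    apply le_antisymm
    · exact le_of_quadForm_le hS0 (hφ0 _ hT) fun x =>
        le_of_tendsto' (tendsto_quadForm hS x) fun n => quadForm_mono (hφm (hle n)) x
    · refine hlub'.2 ?_
      rintro _ ⟨_, ⟨n, rfl⟩, rfl⟩
      refine le_of_quadForm_le (hφ0 _ (h0 n)) hS0 fun x => ?_
      exact Monotone.ge_of_tendsto (f := fun n => (φ (A n)).quadForm x)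
        (fun m n hmn => quadForm_mono (hφm (hm hmn)) x) (tendsto_quadForm hS x) n
  exact this ▸ tendsto_quadForm hS x

end ContinuousLinearMap

/-! ### Operator-valued measures -/

/-- `M` restricted to measurable sets is a measure with values in the positive operators,
equivalently each `B ↦ ⟪x, M(B) x⟫` is a measure. Normalisation is not required, and the values on
non-measurable sets are irrelevant. -/
structure IsPositiveOperatorMeasure {Ω : Type v} [MeasurableSpace Ω] (M : Set Ω → (H →L[ℂ] H)) :
    Prop where
  nonneg : ∀ B, MeasurableSet B → 0 ≤ M B
  exists_measure : ∀ x, ∃ ρ : Measure Ω, ∀ B, MeasurableSet B → ρ B = (M B).quadForm x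

namespace IsPositiveOperatorMeasure

variable {Ω : Type v} [MeasurableSpace Ω] {M : Set Ω → (H →L[ℂ] H)}

theorem of_tsum (h0 : ∀ B, MeasurableSet B → 0 ≤ M B)
    (h : ∀ B : ℕ → Set Ω, (∀ i, MeasurableSet (B i)) → Pairwise (Function.onFun Disjoint B) →
      ∀ x, (M (⋃ i, B i)).quadForm x = ∑' i, (M (B i)).quadForm x) :
    IsPositiveOperatorMeasure M := by
  refine ⟨h0, fun x => ?_⟩
  have hempty : (M ∅).quadForm x = 0 := by
    have h1 := h (fun _ => ∅) (fun _ => .empty) (fun i j _ => by simp [Function.onFun]) x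
    by_contra hne
    rw [Set.iUnion_empty, ENNReal.tsum_const_eq_top_of_ne_zero hne] at h1
    exact quadForm_ne_top _ _ h1
  exact ⟨Measure.ofMeasurable (fun B _ => (M B).quadForm x) hempty
    (fun B hB hd => h B hB hd x), fun B hB => Measure.ofMeasurable_apply B hB⟩

theorem quadForm_iUnion (hM : IsPositiveOperatorMeasure M) {B : ℕ → Set Ω}
    (hB : ∀ i, MeasurableSet (B i))
    (hd : Pairwise (Function.onFun Disjoint B)) (x : H) :
    (M (⋃ i, B i)).quadForm x = ∑' i, (M (B i)).quadForm x := by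
  obtain ⟨ρ, hρ⟩ := hM.exists_measure x
  rw [← hρ _ (.iUnion hB), measure_iUnion hd hB]
  exact tsum_congr fun i => hρ _ (hB i)

theorem hasSum_inner_self (hM : IsPositiveOperatorMeasure M) {B : ℕ → Set Ω}
    (hB : ∀ i, MeasurableSet (B i))
    (hd : Pairwise (Function.onFun Disjoint B)) (x : H) :
    HasSum (fun i => inner ℂ x (M (B i) x)) (inner ℂ x (M (⋃ i, B i) x)) := by
  rw [inner_self_eq_quadForm (hM.nonneg _ (.iUnion hB))]
  simp only [fun i => inner_self_eq_quadForm (hM.nonneg _ (hB i)) x]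
  rw [hM.quadForm_iUnion hB hd]
  refine Complex.hasSum_ofReal.2 ?_
  rw [ENNReal.tsum_toReal_eq fun i => quadForm_ne_top _ _]
  refine (ENNReal.summable_toReal ?_).hasSum
  rw [← hM.quadForm_iUnion hB hd]
  exact quadForm_ne_top _ _

/-- Weak countable additivity, from its diagonal case by polarization. -/
theorem hasSum_inner (hM : IsPositiveOperatorMeasure M) {B : ℕ → Set Ω}
    (hB : ∀ i, MeasurableSet (B i))
    (hd : Pairwise (Function.onFun Disjoint B)) (x y : H) :
    HasSum (fun i => inner ℂ y (M (B i) x)) (inner ℂ y (M (⋃ i, B i) x)) := by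
  have hp : ∀ T : H →L[ℂ] H, inner ℂ y (T x) =
      (inner ℂ (x + y) (T (x + y)) - inner ℂ (x - y) (T (x - y))
        + Complex.I * inner ℂ (x + Complex.I • y) (T (x + Complex.I • y))
        - Complex.I * inner ℂ (x - Complex.I • y) (T (x - Complex.I • y))) / 4 := by
    intro T
    simp only [map_add, map_sub, map_smul, inner_add_left, inner_add_right, inner_sub_left,
      inner_sub_right, inner_smul_left, inner_smul_right, Complex.conj_I]
    linear_combination (1 / 2 * inner ℂ y (T x) - 1 / 2 * inner ℂ x (T y)) * Complex.I_sq
  simp only [hp]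
  have h := fun z => hM.hasSum_inner_self hB hd z
  exact ((((h _).sub (h _)).add ((h _).mul_left _)).sub ((h _).mul_left _)).div_const _

open Classical in
/-- A normalised positive operator measure as a POVM. -/
def toPOVM (hM : IsPositiveOperatorMeasure M) (h1 : M Set.univ = 1) : POVM H Ω where
  effect B := if MeasurableSet B then M B else 0
  effect_nonneg B hB := by rw [if_pos hB]; exact hM.nonneg B hB
  effect_univ := by rw [if_pos .univ, h1]
  effect_iUnion B hB hd := by
    rw [if_pos (MeasurableSet.iUnion hB)]
    simp only [if_pos (hB _)]
    rw [HasSum, ContinuousLinearMapWOT.tendsto_iff_forall_inner_apply_tendsto]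
    intro x y
    have := hM.hasSum_inner hB hd x y
    rw [HasSum] at this
    refine this.congr fun s => ?_
    induction s using Finset.cons_induction with
    | empty => simp
    | cons a s ha ih =>
      rw [Finset.sum_cons, Finset.sum_cons, ContinuousLinearMapWOT.add_apply, inner_add_right, ih]
      rfl
  effect_not_measurable B hB := if_neg hB

theorem toPOVM_effect (hM : IsPositiveOperatorMeasure M) (h1 : M Set.univ = 1) {B : Set Ω}
    (hB : MeasurableSet B) :
    (hM.toPOVM h1).effect B = M B := if_pos hB

end IsPositiveOperatorMeasure

namespace POVM

variable {Ω : Type v} [MeasurableSpace Ω] (E : POVM H Ω)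

theorem vectorMeasure_eq_quadForm (x : H) {B : Set Ω} (hB : MeasurableSet B) :
    E.vectorMeasure x B = (E.effect B).quadForm x := E.vectorMeasure_apply x hB

theorem isPositiveOperatorMeasure : IsPositiveOperatorMeasure E.effect :=
  ⟨E.effect_nonneg, fun x => ⟨E.vectorMeasure x, fun _ hB => E.vectorMeasure_apply x hB⟩⟩

instance (x : H) : IsFiniteMeasure (E.vectorMeasure x) :=
  ⟨by rw [E.vectorMeasure_apply x .univ]; exact ENNReal.ofReal_lt_top⟩

theorem ext_of_vectorMeasure {E F : POVM H Ω} (h : ∀ x, E.vectorMeasure x = F.vectorMeasure x) :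
    E = F := by
  ext1
  funext B
  by_cases hB : MeasurableSet B
  · refine eq_of_quadForm_eq (E.effect_nonneg B hB) (F.effect_nonneg B hB) fun x => ?_
    rw [← vectorMeasure_eq_quadForm E x hB, h, vectorMeasure_eq_quadForm F x hB]
  · rw [E.effect_not_measurable B hB, F.effect_not_measurable B hB]

/-- The image of a POVM under a measurable map of the outcomes. -/
def map {Ω' : Type w} [MeasurableSpace Ω'] (f : Ω → Ω') (hf : Measurable f) : POVM H Ω' :=
  IsPositiveOperatorMeasure.toPOVM (M := fun B => E.effect (f ⁻¹' B))
    ⟨fun B hB => E.effect_nonneg _ (hf hB), fun x => ⟨(E.vectorMeasure x).map f, fun B hB => by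
      rw [Measure.map_apply hf hB, E.vectorMeasure_eq_quadForm x (hf hB)]⟩⟩
    (by rw [Set.preimage_univ, E.effect_univ])

theorem map_effect {Ω' : Type w} [MeasurableSpace Ω'] {f : Ω → Ω'} (hf : Measurable f)
    {B : Set Ω'} (hB : MeasurableSet B) : (E.map f hf).effect B = E.effect (f ⁻¹' B) :=
  IsPositiveOperatorMeasure.toPOVM_effect _ _ hB

end POVM

/-- In terms of the measures `⟪x, E(·) x⟫`, the relation `E₁ ⪯ E₂` says that one Markov kernel maps
all measures of `E₂` to those of `E₁`. -/
theorem fuzzyLE_iff {Ω₁ : Type v} {Ω₂ : Type w} [MeasurableSpace Ω₁] [MeasurableSpace Ω₂]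
    {E₁ : POVM H Ω₁} {E₂ : POVM H Ω₂} : FuzzyLE E₁ E₂ ↔
      ∃ ν : Kernel Ω₂ Ω₁, IsMarkovKernel ν ∧
        ∀ x, E₁.vectorMeasure x = (E₂.vectorMeasure x).bind ν := by
  refine exists_congr fun ν => and_congr_right fun hν => ?_
  have key : ∀ B, MeasurableSet B → ∀ x, Integrable (fun ω => (ν ω).real B) (E₂.vectorMeasure x) ∧
      ∫ ω, (ν ω).real B ∂(E₂.vectorMeasure x) = ((E₂.vectorMeasure x).bind ν B).toReal := by
    intro B hB x
    have hmeas : Measurable fun ω => ν ω B := ν.measurable_coe hB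
    refine ⟨Integrable.of_bound (C := 1) hmeas.ennreal_toReal.aestronglyMeasurable
      (.of_forall fun ω => ?_), ?_⟩
    · rw [Real.norm_of_nonneg measureReal_nonneg]
      exact measureReal_le_one
    · rw [Measure.bind_apply hB ν.aemeasurable]
      exact integral_toReal hmeas.aemeasurable (.of_forall fun ω => measure_lt_top _ _)
  have hfin : ∀ B, ∀ x, (E₂.vectorMeasure x).bind ν B ≠ ⊤ := by
    intro B x
    have : IsFiniteMeasure ((E₂.vectorMeasure x).bind ν) := ⟨by
      rw [Measure.bind_apply .univ ν.aemeasurable]; simp⟩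
    exact measure_ne_top _ _
  constructor
  · intro h x
    ext B hB
    have h1 := (h B hB x).2
    rw [inner_self_eq_quadForm (E₁.effect_nonneg B hB), (key B hB x).2, Complex.ofReal_inj,
      ← POVM.vectorMeasure_eq_quadForm E₁ x hB] at h1
    exact (ENNReal.toReal_eq_toReal_iff' (measure_ne_top _ _) (hfin B x)).1 h1
  · intro h B hB x
    refine ⟨(key B hB x).1, ?_⟩
    rw [inner_self_eq_quadForm (E₁.effect_nonneg B hB), (key B hB x).2, ← h,
      ← POVM.vectorMeasure_eq_quadForm E₁ x hB]

theorem fuzzyLE_of_effect_eq_preimage {Ω₁ : Type v} {Ω₂ : Type w} [MeasurableSpace Ω₁]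
    [MeasurableSpace Ω₂] {E₁ : POVM H Ω₁} {E₂ : POVM H Ω₂} {f : Ω₂ → Ω₁} (hf : Measurable f)
    (h : ∀ B, MeasurableSet B → E₁.effect B = E₂.effect (f ⁻¹' B)) : FuzzyLE E₁ E₂ := by
  refine fuzzyLE_iff.2 ⟨Kernel.deterministic f hf, inferInstance, fun x => ?_⟩
  rw [Measure.deterministic_comp_eq_map]
  ext B hB
  rw [Measure.map_apply hf hB, POVM.vectorMeasure_eq_quadForm _ x hB,
    POVM.vectorMeasure_eq_quadForm _ x (hf hB), h B hB]

/-! ### The operations of an instrument -/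

namespace CPInstrument

variable {Ω : Type v} [MeasurableSpace Ω] (I : CPInstrument H Ω)

theorem op_nonneg (B : Set Ω) {a : H →L[ℂ] H} (ha : 0 ≤ a) : 0 ≤ I.op B a := by
  have := OrderHomClass.mono (I.op B) ha
  rwa [map_zero] at this

theorem hasSum_inner_op {B : ℕ → Set Ω} (hB : ∀ i, MeasurableSet (B i))
    (hd : Pairwise (Function.onFun Disjoint B)) (a : H →L[ℂ] H) (x : H) :
    HasSum (fun i => inner ℂ x (I.op (B i) a x)) (inner ℂ x (I.op (⋃ i, B i) a x)) := by
  have hs : Summable fun k : ℕ => ‖(Pi.single 0 x : ℕ → H) k‖ ^ 2 :=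
    summable_of_ne_finset_zero (s := {0}) fun k hk => by
      rw [Pi.single_eq_of_ne (by simpa using hk)]; simp
  have h := I.op_iUnion B hB hd a (Pi.single 0 x) (Pi.single 0 x) hs hs
  have hsum : ∀ T : H →L[ℂ] H,
      ∑' k, inner ℂ ((Pi.single 0 x : ℕ → H) k) (T ((Pi.single 0 x : ℕ → H) k))
        = inner ℂ x (T x) := by
    intro T
    rw [tsum_eq_single 0 fun k hk => by rw [Pi.single_eq_of_ne hk]; simp]
    simp
  simpa only [hsum] using h

theorem isPositiveOperatorMeasure_op {a : H →L[ℂ] H} (ha : 0 ≤ a) :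
    IsPositiveOperatorMeasure fun B => I.op B a := by
  refine .of_tsum (fun B _ => I.op_nonneg B ha) fun B hB hd x => ?_
  have h := Complex.hasSum_re (I.hasSum_inner_op hB hd a x)
  rw [quadForm, ← h.tsum_eq]
  exact ENNReal.ofReal_tsum_of_nonneg (fun i =>
    ((nonneg_iff_isPositive _).1 (I.op_nonneg (B i) ha)).re_inner_nonneg_right x) h.summable

/-- By normality, an operation of the instrument maps operator measures to operator measures. -/
theorem isPositiveOperatorMeasure_op_comp {X : Type w} [MeasurableSpace X]
    {M : Set X → (H →L[ℂ] H)} (hM : IsPositiveOperatorMeasure M) {C : Set Ω}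
    (hC : MeasurableSet C) : IsPositiveOperatorMeasure fun B => I.op C (M B) := by
  refine .of_tsum (fun B hB => I.op_nonneg C (hM.nonneg B hB)) fun B hB hd x => ?_
  have h0 : ∀ i, 0 ≤ M (B i) := fun i => hM.nonneg _ (hB i)
  have h := tendsto_quadForm_map_of_scottContinuous (I.op_normal C hC) (fun T => I.op_nonneg C)
    (A := fun n => ∑ i ∈ Finset.range n, M (B i)) (T := M (⋃ i, B i))
    (fun n => Finset.sum_nonneg fun i _ => h0 i)
    (monotone_nat_of_le_succ fun n => by
      rw [Finset.sum_range_succ]; exact le_add_of_nonneg_right (h0 n))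
    (hM.nonneg _ (.iUnion hB))
    (fun y => by
      simp only [quadForm_sum _ fun i _ => h0 i]
      rw [hM.quadForm_iUnion hB hd]
      exact ENNReal.tendsto_nat_tsum _) x
  simp only [map_sum, quadForm_sum _ fun i _ => I.op_nonneg C (h0 i)] at h
  exact tendsto_nhds_unique h (ENNReal.tendsto_nat_tsum _)

theorem opSeq_nonneg (l : List (Set Ω)) {a : H →L[ℂ] H} (ha : 0 ≤ a) : 0 ≤ I.opSeq l a := by
  induction l with
  | nil => exact ha
  | cons B l ih => exact I.op_nonneg B ih

theorem opSeq_append (l l' : List (Set Ω)) (a : H →L[ℂ] H) :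
    I.opSeq (l ++ l') a = I.opSeq l (I.opSeq l' a) := by
  induction l with
  | nil => rfl
  | cons B l ih => simp [opSeq, ih]

/-- The composed operations are countably additive in each event separately. -/
theorem isPositiveOperatorMeasure_opSeq {l : List (Set Ω)} (hl : ∀ B ∈ l, MeasurableSet B)
    (l' : List (Set Ω)) {a : H →L[ℂ] H} (ha : 0 ≤ a) :
    IsPositiveOperatorMeasure fun B => I.opSeq (l ++ B :: l') a := by
  induction l with
  | nil => exact I.isPositiveOperatorMeasure_op (I.opSeq_nonneg l' ha)
  | cons C l ih =>
    exact I.isPositiveOperatorMeasure_op_comp (ih fun B hB => hl B (List.mem_cons_of_mem _ hB))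
      (hl C List.mem_cons_self)

end CPInstrument

/-! ### Measures on the Cantor space -/

section CantorSpace


variable {c : ℕ → (ℕ → Bool) → ENNReal}

theorem isClopen_cylinder (b : ℕ → Bool) (n : ℕ) : IsClopen (PiNat.cylinder b n) := by
  refine ⟨?_, PiNat.isOpen_cylinder _ b n⟩
  rw [PiNat.cylinder_eq_pi]
  exact isClosed_set_pi fun i _ => isClosed_discrete _

theorem measurableSet_cylinder (b : ℕ → Bool) (n : ℕ) : MeasurableSet (PiNat.cylinder b n) :=
  (PiNat.isOpen_cylinder _ b n).measurableSet

/-- A discrete measure on the cylinder of depth `m` around `b`, which for a cylinder function `c`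
gives every cylinder of depth at most `m + k` inside it the prescribed mass: the mass `c m b` is
distributed according to the next `k` digits. -/
def discretization (c : ℕ → (ℕ → Bool) → ENNReal) : ℕ → ℕ → (ℕ → Bool) → Measure (ℕ → Bool)
  | 0, m, b => c m b • Measure.dirac b
  | k + 1, m, b => discretization c k (m + 1) (update b m true) +
      discretization c k (m + 1) (update b m false)

theorem discretization_univ
    (hadd : ∀ n b, c n b = c (n + 1) (update b n true) + c (n + 1) (update b n false)) (k m : ℕ)
    (b : ℕ → Bool) : discretization c k m b Set.univ = c m b := by
  induction k generalizing m b with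
  | zero => simp [discretization]
  | succ k ih => rw [discretization, Measure.add_apply, ih, ih, ← hadd]

theorem discretization_compl (k m : ℕ) (b : ℕ → Bool) :
    discretization c k m b (PiNat.cylinder b m)ᶜ = 0 := by
  induction k generalizing m b with
  | zero =>
    rw [discretization, Measure.smul_apply,
      Measure.dirac_apply' _ (measurableSet_cylinder b m).compl]
    simp
  | succ k ih =>
    have hsub : ∀ v, (PiNat.cylinder b m)ᶜ ⊆ (PiNat.cylinder (update b m v) (m + 1))ᶜ := by
      intro v
      rw [Set.compl_subset_compl]
      intro y hy i hi
      rw [hy i (by omega), update_of_ne (by omega)]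
    rw [discretization, Measure.add_apply, measure_mono_null (hsub _) (ih _ _),
      measure_mono_null (hsub _) (ih _ _), add_zero]

theorem discretization_cylinder (hloc : ∀ n b b', (∀ i < n, b i = b' i) → c n b = c n b')
    (hadd : ∀ n b, c n b = c (n + 1) (update b n true) + c (n + 1) (update b n false))
    {k m n : ℕ} {b b' : ℕ → Bool} (hmn : m ≤ n) (hn : n ≤ m + k) (hb : b' ∈ PiNat.cylinder b m) :
    discretization c k m b (PiNat.cylinder b' n) = c n b' := by
  have hbase : ∀ k m (b : ℕ → Bool), b' ∈ PiNat.cylinder b m →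
      discretization c k m b (PiNat.cylinder b' m) = c m b' := by
    intro k m b hb
    rw [PiNat.mem_cylinder_iff_eq.1 hb, hloc m b' b hb, ← discretization_univ hadd k m b]
    exact measure_of_measure_compl_eq_zero (discretization_compl k m b)
  induction k generalizing m b with
  | zero =>
    obtain rfl : m = n := by omega
    exact hbase 0 m b hb
  | succ k ih =>
    obtain rfl | hlt := hmn.eq_or_lt
    · exact hbase _ m b hb
    have hin : ∀ v, b' m = v →
        discretization c k (m + 1) (update b m v) (PiNat.cylinder b' n) = c n b' := by
      intro v hv
      refine ih hlt (by omega) fun i hi => ?_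
      obtain rfl | hne := eq_or_ne i m
      · rw [update_self, hv]
      · rw [update_of_ne hne, hb i (by omega)]
    have hout : ∀ v, b' m ≠ v →
        discretization c k (m + 1) (update b m v) (PiNat.cylinder b' n) = 0 := by
      intro v hv
      have hsub : PiNat.cylinder b' n ⊆ (PiNat.cylinder (update b m v) (m + 1))ᶜ := by
        intro y hy hy'
        have h1 := hy' m (by omega)
        rw [update_self] at h1
        exact hv (by rw [← hy m hlt, h1])
      exact measure_mono_null hsub (discretization_compl k _ _)
    rw [discretization, Measure.add_apply]
    cases hv : b' m
    · rw [hin false hv, hout true (by simp [hv]), zero_add]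
    · rw [hin true hv, hout false (by simp [hv]), add_zero]

/-- Every additive cylinder function on the Cantor space extends to a measure: finitely supported
approximations have a limit point by compactness, and cylinders are clopen. -/
theorem exists_measure_cylinder (hfin : ∀ b, c 0 b ≠ ⊤)
    (hloc : ∀ n b b', (∀ i < n, b i = b' i) → c n b = c n b')
    (hadd : ∀ n b, c n b = c (n + 1) (update b n true) + c (n + 1) (update b n false)) :
    ∃ μ : Measure (ℕ → Bool), IsFiniteMeasure μ ∧ ∀ n b, μ (PiNat.cylinder b n) = c n b := by
  let b₀ : ℕ → Bool := fun _ => false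
  let μ : ℕ → FiniteMeasure (ℕ → Bool) := fun k => ⟨discretization c k 0 b₀,
    ⟨by rw [discretization_univ hadd]; exact (hfin b₀).lt_top⟩⟩
  have hμ : ∀ {k n}, n ≤ k → ∀ b, (μ k : Measure (ℕ → Bool)) (PiNat.cylinder b n) = c n b :=
    fun {k n} hk b => discretization_cylinder hloc hadd (Nat.zero_le _) (by omega) (by simp)
  have hmass : ∀ k, (μ k).mass ≤ (c 0 b₀).toNNReal := by
    intro k
    rw [← ENNReal.coe_le_coe, FiniteMeasure.ennreal_mass, ENNReal.coe_toNNReal (hfin b₀)]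
    exact (discretization_univ hadd k 0 b₀).le
  obtain ⟨ν, -, hν⟩ := isCompact_iff_ultrafilter_le_nhds'.1
    (isCompact_setOfPred_finiteMeasure_le_of_compactSpace (ℕ → Bool) (c 0 b₀).toNNReal)
    ((hyperfilter ℕ).map μ) (Ultrafilter.mem_map.2 (univ_mem' hmass))
  have hlim : Tendsto μ (hyperfilter ℕ) (𝓝 ν) := hν
  refine ⟨ν, inferInstance, fun n b => ?_⟩
  have h := FiniteMeasure.tendsto_iff_forall_integral_tendsto.1 hlim
    (BoundedContinuousFunction.indicator _ (isClopen_cylinder b n))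
  have hint : ∀ ρ : FiniteMeasure (ℕ → Bool),
      ∫ y, BoundedContinuousFunction.indicator _ (isClopen_cylinder b n) y ∂(ρ : Measure (ℕ → Bool))
        = (ρ : Measure (ℕ → Bool)).real (PiNat.cylinder b n) := by
    intro ρ
    exact integral_indicator_one (measurableSet_cylinder b n)
  simp only [hint] at h
  have hev : ∀ᶠ k in (hyperfilter ℕ : Filter ℕ),
      (μ k : Measure (ℕ → Bool)).real (PiNat.cylinder b n) = (c n b).toReal :=
    Nat.hyperfilter_le_atTop ((eventually_ge_atTop n).mono fun k hk => by
      rw [Measure.real, hμ hk])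
  have heq := tendsto_nhds_unique (tendsto_const_nhds.congr' (hev.mono fun _ h => h.symm)) h
  have hc : c n b ≠ ⊤ := by rw [← hμ le_rfl b]; exact measure_ne_top _ _
  exact ((ENNReal.toReal_eq_toReal_iff' hc (measure_ne_top _ _)).1 heq).symm

/-- Additive functions of cylinders that agree at depth `N` agree at all smaller depths. -/
theorem eq_of_eq_of_additive {f g : ℕ → (ℕ → Bool) → ENNReal} {N : ℕ}
    (hf : ∀ t < N, ∀ b, f t b = f (t + 1) (update b t true) + f (t + 1) (update b t false))
    (hg : ∀ t < N, ∀ b, g t b = g (t + 1) (update b t true) + g (t + 1) (update b t false))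
    (h : ∀ b, f N b = g N b) {t : ℕ} (ht : t ≤ N) (b : ℕ → Bool) : f t b = g t b := by
  induction ht using Nat.decreasingInduction generalizing b with
  | self => exact h b
  | of_succ t ht ih => rw [hf t ht, hg t ht, ih, ih]

theorem isPiSystem_cylinders :
    IsPiSystem {A : Set (ℕ → Bool) | ∃ b n, A = PiNat.cylinder b n} := by
  rintro _ ⟨b, n, rfl⟩ _ ⟨b', n', rfl⟩ ⟨y, hy, hy'⟩
  refine ⟨y, max n n', ?_⟩
  rw [← PiNat.mem_cylinder_iff_eq.1 hy, ← PiNat.mem_cylinder_iff_eq.1 hy']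
  ext z
  simp only [Set.mem_inter_iff, PiNat.mem_cylinder_iff, lt_max_iff]
  grind

theorem generateFrom_cylinders : (inferInstance : MeasurableSpace (ℕ → Bool)) =
    MeasurableSpace.generateFrom {A : Set (ℕ → Bool) | ∃ b n, A = PiNat.cylinder b n} := by
  have h := (PiNat.isTopologicalBasis_cylinders (fun _ => Bool)).borel_eq_generateFrom
  rw [← BorelSpace.measurable_eq (α := ℕ → Bool)] at h
  exact h

end CantorSpace

/-! ### Extension of separately additive functions of boxes -/


/-- A function of boxes `B 0 × ⋯ × B (n - 1) × Ω × Ω × ⋯` that is a finite measure in each side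
separately. A box is encoded by its number of sides `n` and a sequence `B` of which only the first
`n` terms matter. -/
structure IsMultimeasure {Ω : Type v} [MeasurableSpace Ω] (Q : ℕ → (ℕ → Set Ω) → ENNReal) :
    Prop where
  exists_measure : ∀ n B k, (∀ i, MeasurableSet (B i)) → k < n → ∃ ρ : Measure Ω,
    IsFiniteMeasure ρ ∧ ∀ A, MeasurableSet A → Q n (update B k A) = ρ A
  succ_of_eq_univ : ∀ n B, (∀ i, MeasurableSet (B i)) → B n = Set.univ → Q (n + 1) B = Q n B
  congr : ∀ n B B', (∀ k < n, B k = B' k) → Q n B = Q n B'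

/-- The sequences whose first `n` terms lie in the sets `B 0, …, B (n - 1)`. -/
def box {Ω : Type v} (n : ℕ) (B : ℕ → Set Ω) : Set (ℕ → Ω) := {ω | ∀ k < n, ω k ∈ B k}

theorem measurableSet_box {Ω : Type v} [MeasurableSpace Ω] (n : ℕ) {B : ℕ → Set Ω}
    (hB : ∀ i, MeasurableSet (B i)) : MeasurableSet (box n B) := by
  have : box n B = ⋂ k, ⋂ (_ : k < n), (fun ω => ω k) ⁻¹' B k := by ext; simp [box]
  rw [this]
  exact .iInter fun k => .iInter fun _ => measurable_pi_apply k (hB k)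

theorem box_succ {Ω : Type v} (n : ℕ) (B : ℕ → Set Ω) :
    box (n + 1) B = box n B ∩ {ω | ω n ∈ B n} := by
  ext ω
  simp only [box, Set.mem_inter_iff, Set.mem_ofPred_eq, Order.lt_add_one_iff]
  exact ⟨fun h => ⟨fun k hk => h k hk.le, h n le_rfl⟩,
    fun h k hk => hk.eq_or_lt.elim (fun e => e ▸ h.2) (h.1 k)⟩

theorem MeasureTheory.Measure.isMultimeasure_box {Ω : Type v} [MeasurableSpace Ω]
    (μ : Measure (ℕ → Ω)) [IsFiniteMeasure μ] : IsMultimeasure fun n B => μ (box n B) where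
  exists_measure n B k hB hk := by
    refine ⟨(μ.restrict {ω | ∀ i < n, i ≠ k → ω i ∈ B i}).map (fun ω => ω k), inferInstance,
      fun A hA => ?_⟩
    rw [Measure.map_apply (measurable_pi_apply k) hA,
      Measure.restrict_apply (measurable_pi_apply k hA)]
    congr 1
    ext ω
    simp only [box, Set.mem_ofPred_eq, Set.mem_inter_iff, Set.mem_preimage]
    constructor
    · intro h
      exact ⟨by simpa using h k hk, fun i hi hik => by simpa [hik] using h i hi⟩
    · rintro ⟨h1, h2⟩ i hi
      obtain rfl | hik := eq_or_ne i k
      · simpa using h1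
      · simpa [hik] using h2 i hi hik
  succ_of_eq_univ n B _ h := by simp [box_succ, h]
  congr n B B' h := by
    congr 1
    ext ω
    exact forall₂_congr fun k hk => by rw [h k hk]

namespace IsMultimeasure

variable {Ω : Type v} [MeasurableSpace Ω] {Q : ℕ → (ℕ → Set Ω) → ENNReal}

theorem comap (hQ : IsMultimeasure Q) {Y : Type w} [MeasurableSpace Y] {e : Ω → Y}
    (he : Measurable e) : IsMultimeasure fun n (C : ℕ → Set Y) => Q n fun k => e ⁻¹' C k where
  exists_measure n C k hC hk := by
    obtain ⟨ρ, hρ, h⟩ := hQ.exists_measure n (fun k => e ⁻¹' C k) k (fun i => he (hC i)) hk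
    refine ⟨ρ.map e, inferInstance, fun A hA => ?_⟩
    rw [Measure.map_apply he hA, ← h _ (he hA)]
    congr 1
    funext i
    obtain rfl | hik := eq_or_ne i k
    · simp
    · simp [hik]
  succ_of_eq_univ n C hC h := hQ.succ_of_eq_univ n _ (fun i => he (hC i)) (by simp [h])
  congr n C C' h := hQ.congr n _ _ fun k hk => by rw [h k hk]

/-- Multimeasures agree on all boxes if they do so on boxes with sides in a generating
π-system; the sides are replaced one after the other. -/
theorem ext_of_generate (hQ : IsMultimeasure Q) {R : ℕ → (ℕ → Set Ω) → ENNReal}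
    (hR : IsMultimeasure R) {P : Set (Set Ω)} (hgen : ‹MeasurableSpace Ω› = .generateFrom P)
    (hpi : IsPiSystem P) (huniv : Set.univ ∈ P)
    (h : ∀ n B, (∀ k, B k ∈ P) → Q n B = R n B) (n : ℕ) {B : ℕ → Set Ω}
    (hB : ∀ k, MeasurableSet (B k)) : Q n B = R n B := by
  have hPm : ∀ A ∈ P, MeasurableSet A := fun A hA => by
    rw [hgen]; exact MeasurableSpace.measurableSet_generateFrom hA
  have key : ∀ j ≤ n, ∀ B : ℕ → Set Ω, (∀ k, MeasurableSet (B k)) → (∀ k ≥ j, B k ∈ P) →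
      Q n B = R n B := by
    intro j
    induction j with
    | zero => exact fun _ B _ hP => h n B fun k => hP k (Nat.zero_le k)
    | succ j ih =>
      intro hj B hB hP
      obtain ⟨ρ, hρ, h1⟩ := hQ.exists_measure n B j hB hj
      obtain ⟨σ, hσ, h2⟩ := hR.exists_measure n B j hB hj
      have hon : ∀ A ∈ P, ρ A = σ A := by
        intro A hA
        rw [← h1 A (hPm A hA), ← h2 A (hPm A hA)]
        refine ih (by omega) _ (fun k => ?_) fun k hk => ?_
        · obtain rfl | hkj := eq_or_ne k j
          · simpa using hPm A hA
          · simpa [hkj] using hB k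
        · obtain rfl | hkj := eq_or_ne k j
          · simpa using hA
          · simpa [hkj] using hP k (by omega)
      have := ext_of_generate_finite P hgen hpi hon (hon _ huniv)
      rw [← update_eq_self j B, h1 _ (hB j), h2 _ (hB j), this]
  rw [hQ.congr n B (fun k => if k < n then B k else Set.univ) fun k hk => by simp [hk],
    hR.congr n B (fun k => if k < n then B k else Set.univ) fun k hk => by simp [hk]]
  refine key n le_rfl _ (fun k => ?_) fun k hk => by simpa [hk.not_gt] using huniv
  split_ifs
  exacts [hB k, .univ]

theorem eq_of_le (hQ : IsMultimeasure Q) {B : ℕ → Set Ω} (hB : ∀ i, MeasurableSet (B i)) {n N : ℕ}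
    (hn : n ≤ N) (h : ∀ k, n ≤ k → B k = Set.univ) : Q N B = Q n B := by
  induction N, hn using Nat.le_induction with
  | base => rfl
  | succ N hN ih => rw [hQ.succ_of_eq_univ N B hB (h N hN), ih]

theorem ne_top (hQ : IsMultimeasure Q) (n : ℕ) {B : ℕ → Set Ω} (hB : ∀ i, MeasurableSet (B i)) :
    Q n B ≠ ⊤ := by
  have hpos : ∀ n > 0, ∀ B : ℕ → Set Ω, (∀ i, MeasurableSet (B i)) → Q n B ≠ ⊤ := by
    intro n hn B hB
    obtain ⟨ρ, hρ, h⟩ := hQ.exists_measure n B 0 hB hn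
    rw [← update_eq_self 0 B, h _ (hB 0)]
    exact measure_ne_top _ _
  obtain rfl | hn := Nat.eq_zero_or_pos n
  · rw [hQ.congr 0 B (fun _ => Set.univ) (by simp), ← hQ.succ_of_eq_univ 0 _ (by simp) rfl]
    exact hpos 1 one_pos _ (by simp)
  · exact hpos n hn B hB

theorem eq_zero_of_empty (hQ : IsMultimeasure Q) {n k : ℕ} (hk : k < n) {B : ℕ → Set Ω}
    (hB : ∀ i, MeasurableSet (B i)) (h : B k = ∅) : Q n B = 0 := by
  obtain ⟨ρ, -, hρ⟩ := hQ.exists_measure n B k hB hk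
  rw [← update_eq_self k B, h, hρ _ .empty, measure_empty]

theorem split (hQ : IsMultimeasure Q) {n k : ℕ} (hk : k < n) {B : ℕ → Set Ω}
    (hB : ∀ i, MeasurableSet (B i)) {A : Set Ω} (hA : MeasurableSet A) :
    Q n B = Q n (update B k (B k ∩ A)) + Q n (update B k (B k \ A)) := by
  obtain ⟨ρ, -, hρ⟩ := hQ.exists_measure n B k hB hk
  conv_lhs => rw [← update_eq_self k B]
  rw [hρ _ (hB k), hρ _ ((hB k).inter hA), hρ _ ((hB k).diff hA), measure_inter_add_sdiff _ hA]

end IsMultimeasure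

/-- The points of `Ω` that may stand at place `k` of a sequence whose first `t` digits are those of
`b`. Digit `i` of a sequence is digit `i.unpair.2` (with respect to the coding `e` of points by
binary sequences) of its term number `i.unpair.1`. -/
def digitCell {Ω : Type v} (e : Ω → ℕ → Bool) (t : ℕ) (b : ℕ → Bool) (k : ℕ) : Set Ω :=
  {ω | ∀ i < t, i.unpair.1 = k → e ω i.unpair.2 = b i}

section DigitCell

variable {Ω : Type v} [MeasurableSpace Ω] {e : Ω → ℕ → Bool}

theorem measurableSet_digitCell (he : Measurable e) (t : ℕ) (b : ℕ → Bool) (k : ℕ) :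
    MeasurableSet (digitCell e t b k) := by
  have : digitCell e t b k = ⋂ i, ⋂ (_ : i < t), ⋂ (_ : i.unpair.1 = k),
      {ω | e ω i.unpair.2 = b i} := by ext; simp [digitCell]
  rw [this]
  exact .iInter fun i => .iInter fun _ => .iInter fun _ =>
    (measurable_pi_apply _).comp he (measurableSet_singleton (b i))

theorem digitCell_of_le (t : ℕ) (b : ℕ → Bool) {k : ℕ} (hk : t ≤ k) :
    digitCell e t b k = Set.univ :=
  Set.eq_univ_of_forall fun ω i hi hik => by
    have := Nat.unpair_left_le i
    omega

theorem digitCell_congr {t : ℕ} {b b' : ℕ → Bool} (h : ∀ i < t, b i = b' i) (k : ℕ) :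
    digitCell e t b k = digitCell e t b' k := by
  ext ω
  exact forall₂_congr fun i hi => by rw [h i hi]

theorem digitCell_succ_update (t : ℕ) (b : ℕ → Bool) (v : Bool) (k : ℕ) :
    digitCell e (t + 1) (update b t v) k =
      digitCell e t b k ∩ {ω | t.unpair.1 = k → e ω t.unpair.2 = v} := by
  ext ω
  simp only [digitCell, Set.mem_inter_iff, Set.mem_ofPred_eq]
  constructor
  · refine fun h => ⟨fun i hi hik => ?_, fun hk => by simpa using h t (by omega) hk⟩
    rw [h i (by omega) hik, update_of_ne hi.ne]
  · rintro ⟨h1, h2⟩ i hi hik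
    obtain rfl | hne := eq_or_ne i t
    · simpa using h2 hik
    · rw [update_of_ne hne]; exact h1 i (by omega) hik

theorem IsMultimeasure.digitCell_inter_add {Q : ℕ → (ℕ → Set Ω) → ENNReal} (hQ : IsMultimeasure Q)
    (he : Measurable e) {D : ℕ → Set Ω} (hD : ∀ k, MeasurableSet (D k)) {t N : ℕ} (ht : t < N)
    (b : ℕ → Bool) :
    Q N (fun k => digitCell e t b k ∩ D k) =
      Q N (fun k => digitCell e (t + 1) (update b t true) k ∩ D k) +
        Q N (fun k => digitCell e (t + 1) (update b t false) k ∩ D k) := by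
  have hk : t.unpair.1 < N := (Nat.unpair_left_le t).trans_lt ht
  have hA : MeasurableSet {ω | e ω t.unpair.2 = true} :=
    (measurable_pi_apply _).comp he (measurableSet_singleton true)
  rw [hQ.split hk (fun k => (measurableSet_digitCell he t b k).inter (hD k)) hA]
  congr 2
  all_goals
    funext k
    rw [digitCell_succ_update]
    obtain rfl | hne := eq_or_ne k t.unpair.1
    · ext ω
      simp
      tauto
    · rw [update_of_ne hne]
      ext ω
      simp [hne.symm]

/-- The binary digits of all terms of a sequence. -/
def digits (e : Ω → ℕ → Bool) (ω : ℕ → Ω) (i : ℕ) : Bool := e (ω i.unpair.1) i.unpair.2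

/-- The `k`-th of the binary sequences that are interleaved in `b`. -/
def row (b : ℕ → Bool) (k : ℕ) : ℕ → Bool := fun j => b (Nat.pair k j)

theorem measurable_row : Measurable row :=
  measurable_pi_lambda _ fun k => measurable_pi_lambda _ fun j => measurable_pi_apply (Nat.pair k j)

theorem measurable_digits (he : Measurable e) : Measurable (digits e) :=
  measurable_pi_lambda _ fun i =>
    (measurable_pi_apply _).comp (he.comp (measurable_pi_apply i.unpair.1))

theorem row_digits (ω : ℕ → Ω) (k : ℕ) : row (digits e ω) k = e (ω k) := by
  funext j
  simp [row, digits]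

theorem digits_eq_iff (ω : ℕ → Ω) (b : ℕ → Bool) :
    digits e ω = b ↔ ∀ k, e (ω k) = row b k := by
  constructor
  · rintro rfl k
    rw [row_digits]
  · intro h
    funext i
    simp [digits, h, row]

end DigitCell

/-- A multimeasure on a measurable space coded by binary digits induces a measure on the Cantor
space, of which it gives the masses of boxes of digits. -/
theorem IsMultimeasure.exists_measure_row {Ω : Type v} [MeasurableSpace Ω]
    {Q : ℕ → (ℕ → Set Ω) → ENNReal} (hQ : IsMultimeasure Q) {e : Ω → ℕ → Bool}
    (he : Measurable e) : ∃ μ : Measure (ℕ → Bool), IsFiniteMeasure μ ∧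
      ∀ n (C : ℕ → Set (ℕ → Bool)), (∀ k, MeasurableSet (C k)) →
        μ (row ⁻¹' box n C) = Q n fun k => e ⁻¹' C k := by
  obtain ⟨μ, hμ, hc⟩ := exists_measure_cylinder (c := fun t b => Q t (digitCell e t b))
    (fun b => hQ.ne_top 0 (measurableSet_digitCell he 0 b))
    (fun t b b' h => by rw [funext (digitCell_congr h)])
    (fun t b => by
      have h := hQ.digitCell_inter_add he (D := fun _ => Set.univ) (fun _ => .univ)
        (lt_add_one t) b
      simp only [Set.inter_univ] at h
      rw [← h]
      exact (hQ.succ_of_eq_univ t _ (measurableSet_digitCell he t b)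
        (digitCell_of_le t b le_rfl)).symm)
  have hdeep : ∀ {t N}, t ≤ N → ∀ b, μ (PiNat.cylinder b t) = Q N (digitCell e t b) :=
    fun {t N} ht b => (hc t b).trans (hQ.eq_of_le (measurableSet_digitCell he t b) ht
      fun k hk => digitCell_of_le t b hk).symm
  refine ⟨μ, hμ, fun n C hC => ?_⟩
  have hmul : IsMultimeasure fun n C => μ (row ⁻¹' box n C) := by
    have := MeasureTheory.Measure.isMultimeasure_box (μ.map row)
    refine ⟨fun n B k hB hk => ?_, fun n B hB h => ?_, fun n B B' h => ?_⟩
    · obtain ⟨ρ, hρ, h⟩ := this.exists_measure n B k hB hk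
      refine ⟨ρ, hρ, fun A hA => ?_⟩
      rw [← h A hA, Measure.map_apply measurable_row]
      refine measurableSet_box n fun i => ?_
      obtain rfl | hik := eq_or_ne i k
      · simpa using hA
      · simpa [hik] using hB i
    · simp [box_succ, h]
    · congr 1
      ext b
      exact forall₂_congr fun k hk => by rw [h k hk]
  refine hmul.ext_of_generate (hQ.comap he) generateFrom_cylinders isPiSystem_cylinders
    ⟨fun _ => false, 0, by simp⟩ (fun n C hC => ?_) n hC
  choose r m hrm using hC
  obtain rfl : C = fun k => PiNat.cylinder (r k) (m k) := funext hrm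
  -- All digits on which the box depends come before the depth `N`.
  obtain ⟨N, hnN, hN⟩ : ∃ N, n ≤ N ∧ ∀ k < n, ∀ j < m k, Nat.pair k j < N := by
    refine ⟨n + ∑ k ∈ Finset.range n, ∑ j ∈ Finset.range (m k), (Nat.pair k j + 1),
      Nat.le_add_right _ _, fun k hk j hj => ?_⟩
    have h1 := Finset.single_le_sum (f := fun k => ∑ j ∈ Finset.range (m k), (Nat.pair k j + 1))
      (fun _ _ => Nat.zero_le _) (Finset.mem_range.2 hk)
    have h2 := Finset.single_le_sum (f := fun j => Nat.pair k j + 1)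
      (fun _ _ => Nat.zero_le _) (Finset.mem_range.2 hj)
    omega
  let D : ℕ → Set Ω := fun k => if k < n then e ⁻¹' PiNat.cylinder (r k) (m k) else Set.univ
  have hD : ∀ k, MeasurableSet (D k) := fun k => by
    simp only [D]
    split_ifs
    exacts [he (measurableSet_cylinder _ _), .univ]
  let S : Set (ℕ → Bool) := row ⁻¹' box n fun k => PiNat.cylinder (r k) (m k)
  have hkey : μ (PiNat.cylinder (fun _ => false) 0 ∩ S) =
      Q N fun k => digitCell e 0 (fun _ => false) k ∩ D k := by
    refine eq_of_eq_of_additive (f := fun t b => μ (PiNat.cylinder b t ∩ S))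
      (g := fun t b => Q N fun k => digitCell e t b k ∩ D k) (N := N) (fun t _ b => ?_)
      (fun t ht b => hQ.digitCell_inter_add he hD ht b) (fun b => ?_) (Nat.zero_le N) _
    · rw [← measure_inter_add_sdiff (PiNat.cylinder b t ∩ S)
        (measurable_pi_apply t (measurableSet_singleton true))]
      have hcyl : ∀ v, PiNat.cylinder (update b t v) (t + 1) =
          PiNat.cylinder b t ∩ {y | y t = v} := by
        intro v
        ext y
        simp only [PiNat.mem_cylinder_iff, Set.mem_inter_iff, Set.mem_ofPred_eq]
        constructor
        · exact fun h => ⟨fun i hi => by rw [h i (by omega), update_of_ne hi.ne],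
            by simpa using h t (by omega)⟩
        · rintro ⟨h1, h2⟩ i hi
          obtain rfl | hne := eq_or_ne i t
          · simpa using h2
          · rw [update_of_ne hne]; exact h1 i (by omega)
      rw [hcyl, hcyl]
      congr 2
      all_goals
        ext y
        simp
        tauto
    · by_cases hb : b ∈ S
      · have h1 : PiNat.cylinder b N ∩ S = PiNat.cylinder b N :=
          Set.inter_eq_left.2 fun y hy k hk j hj => by
            rw [← hb k hk j hj]; exact hy _ (hN k hk j hj)
        have h2 : ∀ k, digitCell e N b k ∩ D k = digitCell e N b k := by
          refine fun k => Set.inter_eq_left.2 fun ω hω => ?_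
          simp only [D]
          split_ifs with hk
          · intro j hj
            rw [← hb k hk j hj]
            have := hω (Nat.pair k j) (hN k hk j hj) (by simp)
            rwa [Nat.unpair_pair] at this
          · trivial
        simp only [h1, h2]
        exact hdeep le_rfl b
      · obtain ⟨k, hk, j, hj, hne⟩ : ∃ k, k < n ∧ ∃ j, j < m k ∧ row b k j ≠ r k j := by
          by_contra! hcon
          exact hb fun k hk j hj => hcon k hk j hj
        have h1 : PiNat.cylinder b N ∩ S = ∅ := by
          refine Set.eq_empty_of_forall_notMem fun y hy => hne ?_
          rw [← hy.2 k hk j hj]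
          exact (hy.1 _ (hN k hk j hj)).symm
        simp only [h1, measure_empty]
        refine (hQ.eq_zero_of_empty (hk.trans_le hnN)
          (fun k => (measurableSet_digitCell he N b k).inter (hD k)) ?_).symm
        refine Set.eq_empty_of_forall_notMem fun ω hω => hne ?_
        have h2 := hω.1 (Nat.pair k j) (hN k hk j hj) (by simp)
        have h3 : ω ∈ e ⁻¹' PiNat.cylinder (r k) (m k) := by simpa [D, hk] using hω.2
        rw [Nat.unpair_pair] at h2
        rw [← h3 j hj]
        exact h2.symm
  rw [PiNat.cylinder_zero, Set.univ_inter] at hkey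
  simp only [digitCell_of_le 0 _ (Nat.zero_le _), Set.univ_inter] at hkey
  rw [show μ (row ⁻¹' box n fun k => PiNat.cylinder (r k) (m k)) = Q N D from hkey,
    hQ.eq_of_le hD hnN fun k hk => by simp [D, hk.not_gt]]
  exact hQ.congr n _ _ fun k hk => by simp [D, hk]

/-- On a standard Borel space every multimeasure extends to a measure on the sequence space: the
measure of the digits is concentrated on the codes of sequences, since each of its rows is almost
surely a code. -/
theorem IsMultimeasure.exists_measure_box {Ω : Type v} [MeasurableSpace Ω] [StandardBorelSpace Ω]
    {Q : ℕ → (ℕ → Set Ω) → ENNReal} (hQ : IsMultimeasure Q) :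
    ∃ μ : Measure (ℕ → Ω), IsFiniteMeasure μ ∧
      ∀ n (B : ℕ → Set Ω), (∀ k, MeasurableSet (B k)) → μ (box n B) = Q n B := by
  let e : Ω → ℕ → Bool := MeasurableSpace.mapNatBool Ω
  have he : Measurable e := MeasurableSpace.measurable_mapNatBool Ω
  have hinj : Injective e := MeasurableSpace.injective_mapNatBool Ω
  have hemb : MeasurableEmbedding e := he.measurableEmbedding hinj
  have hT : MeasurableEmbedding (digits e) := (measurable_digits he).measurableEmbedding
    fun ω ω' h => funext fun k => hinj (by rw [← row_digits (e := e) ω k, h, row_digits])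
  obtain ⟨μ, hμ, hbox⟩ := hQ.exists_measure_row he
  have hnull : μ (Set.range (digits e))ᶜ = 0 := by
    have hk : ∀ k, μ {b | row b k ∉ Set.range e} = 0 := by
      intro k
      let C : ℕ → Set (ℕ → Bool) := fun i => if i = k then (Set.range e)ᶜ else Set.univ
      have hC : ∀ i, MeasurableSet (C i) := fun i => by
        simp only [C]
        split_ifs
        exacts [hemb.measurableSet_range.compl, .univ]
      refine measure_mono_null (t := row ⁻¹' box (k + 1) C) (fun b hb i _ => ?_) ?_
      · obtain rfl | hik := eq_or_ne i k
        · simpa [C] using hb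
        · simp [C, hik]
      · rw [hbox _ _ hC]
        exact hQ.eq_zero_of_empty (lt_add_one k) (fun i => he (hC i)) (by simp [C])
    refine measure_mono_null (fun b hb => ?_) (measure_iUnion_null hk)
    by_contra hcon
    simp only [Set.mem_iUnion, Set.mem_ofPred_eq, not_exists, not_not] at hcon
    choose ω hω using hcon
    exact hb ⟨ω, (digits_eq_iff ω b).2 hω⟩
  refine ⟨μ.comap (digits e), ⟨?_⟩, fun n B hB => ?_⟩
  · rw [hT.comap_apply]
    exact measure_lt_top _ _
  · have himg : digits e '' box n B = (row ⁻¹' box n fun k => e '' B k) ∩ Set.range (digits e) := by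
      ext b
      constructor
      · rintro ⟨ω, hω, rfl⟩
        exact ⟨fun k hk => by rw [row_digits]; exact Set.mem_image_of_mem _ (hω k hk), ω, rfl⟩
      · rintro ⟨hb, ω, rfl⟩
        refine ⟨ω, fun k hk => ?_, rfl⟩
        have := hb k hk
        rw [row_digits] at this
        exact (hinj.mem_set_image).1 this
    rw [hT.comap_apply, himg, measure_inter_conull hnull,
      hbox n _ fun k => hemb.measurableSet_image' (hB k)]
    simp only [Set.preimage_image_eq _ hinj]

section Box

variable {Ω : Type v} [MeasurableSpace Ω]

theorem isPiSystem_boxes :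
    IsPiSystem {S : Set (ℕ → Ω) | ∃ n B, (∀ k, MeasurableSet (B k)) ∧ S = box n B} := by
  rintro _ ⟨n, B, hB, rfl⟩ _ ⟨m, C, hC, rfl⟩ -
  refine ⟨max n m, fun k => (if k < n then B k else Set.univ) ∩ if k < m then C k else Set.univ,
    fun k => ?_, ?_⟩
  · refine .inter ?_ ?_ <;> split_ifs
    exacts [hB k, .univ, hC k, .univ]
  · ext ω
    simp only [box, Set.mem_inter_iff, Set.mem_ofPred_eq, lt_max_iff]
    constructor
    · rintro ⟨h1, h2⟩ k -
      constructor <;> split_ifs with h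
      exacts [h1 k h, trivial, h2 k h, trivial]
    · intro h
      exact ⟨fun k hk => by simpa [hk] using (h k (.inl hk)).1,
        fun k hk => by simpa [hk] using (h k (.inr hk)).2⟩

theorem generateFrom_boxes : (MeasurableSpace.pi : MeasurableSpace (ℕ → Ω)) =
    .generateFrom {S | ∃ n B, (∀ k, MeasurableSet (B k)) ∧ S = box n B} := by
  apply le_antisymm
  · refine iSup_le fun i => ?_
    rintro _ ⟨s, hs, rfl⟩
    refine MeasurableSpace.measurableSet_generateFrom
      ⟨i + 1, fun k => if k = i then s else Set.univ, fun k => ?_, ?_⟩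
    · dsimp only
      split_ifs
      exacts [hs, .univ]
    · ext ω
      constructor
      · intro h k _
        dsimp only
        split_ifs with hk
        · exact hk ▸ h
        · trivial
      · exact fun h => by simpa using h i (lt_add_one i)
  · refine MeasurableSpace.generateFrom_le ?_
    rintro _ ⟨n, B, hB, rfl⟩
    exact measurableSet_box n hB

@[simp] theorem box_zero (B : ℕ → Set Ω) : box 0 B = Set.univ := by simp [box]

theorem MeasureTheory.Measure.ext_of_box {μ ν : Measure (ℕ → Ω)} [IsFiniteMeasure μ]
    (h : ∀ n (B : ℕ → Set Ω), (∀ k, MeasurableSet (B k)) → μ (box n B) = ν (box n B)) : μ = ν := by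
  refine ext_of_generate_finite _ generateFrom_boxes isPiSystem_boxes ?_ ?_
  · rintro _ ⟨n, B, hB, rfl⟩
    exact h n B hB
  · simpa using h 0 (fun _ => Set.univ) fun _ => .univ

end Box

/-! ### Existence and uniqueness of the infinite composition -/

/-- A family of measures whose values on a generating π-system come from operators, and whose total
masses are `‖x‖²`, comes from a POVM: the sets on which the values come from an operator form a
λ-system, for countable disjoint unions by Vigier's theorem. -/
theorem exists_povm_of_measures {Y : Type w} [MeasurableSpace Y] {P : Set (Set Y)}
    (hgen : ‹MeasurableSpace Y› = .generateFrom P) (hpi : IsPiSystem P) {μ : H → Measure Y}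
    (huniv : ∀ x, μ x Set.univ = (1 : H →L[ℂ] H).quadForm x)
    (h : ∀ S ∈ P, ∃ T : H →L[ℂ] H, 0 ≤ T ∧ ∀ x, T.quadForm x = μ x S) :
    ∃ E : POVM H Y, ∀ x, E.vectorMeasure x = μ x := by
  have h1 : (0 : H →L[ℂ] H) ≤ 1 := (nonneg_iff_isPositive _).2 isPositive_one
  have hfin : ∀ x, IsFiniteMeasure (μ x) := fun x =>
    ⟨by rw [huniv]; exact (quadForm_ne_top _ _).lt_top⟩
  have hle : ∀ {T : H →L[ℂ] H} {S : Set Y}, 0 ≤ T → (∀ x, T.quadForm x = μ x S) → T ≤ 1 :=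
    fun hT hq => le_of_quadForm_le hT h1 fun x => by
      rw [hq, ← huniv]; exact measure_mono (Set.subset_univ _)
  have hall : ∀ S, MeasurableSet S → ∃ T : H →L[ℂ] H, 0 ≤ T ∧ ∀ x, T.quadForm x = μ x S := by
    refine MeasurableSpace.induction_on_inter hgen hpi ?_ h ?_ ?_
    · exact ⟨0, le_rfl, by simp⟩
    · rintro S hS ⟨T, hT, hq⟩
      have hT' : 0 ≤ 1 - T := sub_nonneg.2 (hle hT hq)
      refine ⟨1 - T, hT', fun x => ?_⟩
      rw [measure_compl hS (measure_ne_top _ _), ← hq, huniv]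
      refine ENNReal.eq_sub_of_add_eq (quadForm_ne_top _ _) ?_
      rw [← quadForm_add hT' hT, sub_add_cancel]
    · intro S hd hS hT
      choose T hT hq using hT
      have hsum : ∀ n x, (∑ i ∈ Finset.range n, T i).quadForm x = ∑ i ∈ Finset.range n, μ x (S i) :=
        fun n x => by rw [quadForm_sum _ fun i _ => hT i]; simp only [hq]
      have h0 : ∀ n, 0 ≤ ∑ i ∈ Finset.range n, T i := fun n => Finset.sum_nonneg fun i _ => hT i
      obtain ⟨A, hA⟩ := exists_tendsto_of_monotone (A := fun n => ∑ i ∈ Finset.range n, T i)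
        (C := 1) h0 (monotone_nat_of_le_succ fun n => by
          rw [Finset.sum_range_succ]; exact le_add_of_nonneg_right (hT n))
        (fun n => le_of_quadForm_le (h0 n) h1 fun x => by
          rw [hsum, ← huniv, ← measure_biUnion_finset (fun i _ j _ hij => hd hij) fun i _ => hS i]
          exact measure_mono (Set.subset_univ _))
      refine ⟨A, nonneg_of_tendsto h0 hA, fun x => tendsto_nhds_unique (tendsto_quadForm hA x) ?_⟩
      simp only [hsum]
      rw [measure_iUnion hd hS]
      exact ENNReal.tendsto_nat_tsum _
  choose! M hM using hall
  have hMq : ∀ x S, MeasurableSet S → (M S).quadForm x = μ x S := fun x S hS => (hM S hS).2 x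
  have hMpom : IsPositiveOperatorMeasure M :=
    ⟨fun S hS => (hM S hS).1, fun x => ⟨μ x, fun S hS => (hMq x S hS).symm⟩⟩
  have hM1 : M Set.univ = 1 := eq_of_quadForm_eq (hM _ .univ).1 h1 fun x => by
    rw [hMq x _ .univ, huniv]
  refine ⟨hMpom.toPOVM hM1, fun x => ?_⟩
  ext S hS
  rw [POVM.vectorMeasure_eq_quadForm _ x hS, hMpom.toPOVM_effect hM1 hS, hMq x S hS]

namespace CPInstrument

variable {Ω : Type v} [MeasurableSpace Ω] (I : CPInstrument H Ω)

/-- The composed operation `I_{B 0} ∘ ⋯ ∘ I_{B (n - 1)}`, which depends only on the first `n` terms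
of the sequence `B`. -/
def opBox (n : ℕ) (B : ℕ → Set Ω) (a : H →L[ℂ] H) : H →L[ℂ] H :=
  I.opSeq (List.ofFn fun i : Fin n => B i) a

theorem opBox_zero (B : ℕ → Set Ω) (a : H →L[ℂ] H) : I.opBox 0 B a = a := by
  simp [opBox, opSeq]

theorem opBox_succ (n : ℕ) (B : ℕ → Set Ω) (a : H →L[ℂ] H) :
    I.opBox (n + 1) B a = I.opBox n B (I.op (B n) a) := by
  rw [opBox, List.ofFn_succ', List.concat_eq_append, opSeq_append]
  rfl

theorem opBox_succ' (n : ℕ) (B : ℕ → Set Ω) (a : H →L[ℂ] H) :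
    I.opBox (n + 1) B a = I.op (B 0) (I.opBox n (fun k => B (k + 1)) a) := by
  rw [opBox, List.ofFn_succ]
  rfl

theorem opBox_nonneg (n : ℕ) (B : ℕ → Set Ω) {a : H →L[ℂ] H} (ha : 0 ≤ a) : 0 ≤ I.opBox n B a :=
  I.opSeq_nonneg _ ha

theorem isMultimeasure_opBox (x : H) : IsMultimeasure fun n B => (I.opBox n B 1).quadForm x where
  exists_measure n B k hB hk := by
    let l := List.ofFn fun i : Fin n => B i
    have hl : ∀ C ∈ l.take k, MeasurableSet C := fun C hC => by
      obtain ⟨i, rfl⟩ := List.mem_ofFn.1 (List.mem_of_mem_take hC)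
      exact hB i
    obtain ⟨ρ, hρ⟩ := (I.isPositiveOperatorMeasure_opSeq hl (l.drop (k + 1))
      ((nonneg_iff_isPositive _).2 isPositive_one)).exists_measure x
    refine ⟨ρ, ⟨by rw [hρ _ .univ]; exact (quadForm_ne_top _ _).lt_top⟩, fun A hA => ?_⟩
    rw [hρ A hA, opBox]
    congr 2
    have hlen : k < l.length := by simpa [l] using hk
    rw [show l.take k ++ A :: l.drop (k + 1) = l.set k A by
      rw [List.set_eq_take_append_cons_drop, if_pos hlen]]
    refine List.ext_getElem (by simp [l]) fun i h1 h2 => ?_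
    obtain rfl | hik := eq_or_ne i k
    · simp
    · simp [hik, hik.symm, l]
  succ_of_eq_univ n B _ h := by rw [opBox_succ, h, I.op_univ_one]
  congr n B B' h := by
    rw [opBox, opBox]
    congr 3
    funext i
    exact h i i.2

theorem isInfiniteComposition_iff {E : POVM H (ℕ → Ω)} : I.IsInfiniteComposition E ↔
    ∀ n (B : ℕ → Set Ω), (∀ k, MeasurableSet (B k)) → E.effect (box n B) = I.opBox n B 1 := by
  constructor
  · intro h n B hB
    obtain rfl | hn := Nat.eq_zero_or_pos n
    · rw [box_zero, E.effect_univ, opBox_zero]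
    · rw [opBox, ← h n hn _ fun i => hB i]
      congr 1
      ext ω
      exact ⟨fun h i => h i i.2, fun h k hk => h ⟨k, hk⟩⟩
  · intro h n _ B hB
    have h' := h n (fun k => if hk : k < n then B ⟨k, hk⟩ else Set.univ) fun k => by
      split_ifs
      exacts [hB _, .univ]
    simp only [opBox, Fin.is_lt, dite_true, Fin.eta] at h'
    rw [← h']
    congr 1
    ext ω
    simp only [box, Set.mem_ofPred_eq, Fin.forall_iff]
    exact forall₂_congr fun k hk => by simp [hk]

theorem existsUnique_infiniteComposition [StandardBorelSpace Ω] :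
    ∃! E : POVM H (ℕ → Ω), I.IsInfiniteComposition E := by
  choose μ _ hμ using fun x => (I.isMultimeasure_opBox x).exists_measure_box
  have h1 : (0 : H →L[ℂ] H) ≤ 1 := (nonneg_iff_isPositive _).2 isPositive_one
  obtain ⟨E, hE⟩ := exists_povm_of_measures generateFrom_boxes isPiSystem_boxes (μ := μ)
    (fun x => by simpa [opBox_zero] using hμ x 0 (fun _ => Set.univ) fun _ => .univ)
    (by
      rintro _ ⟨n, B, hB, rfl⟩
      exact ⟨I.opBox n B 1, I.opBox_nonneg n B h1, fun x => (hμ x n B hB).symm⟩)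
  refine ⟨E, I.isInfiniteComposition_iff.2 fun n B hB => ?_, fun F hF => ?_⟩
  · refine eq_of_quadForm_eq (E.effect_nonneg _ (measurableSet_box n hB)) (I.opBox_nonneg n B h1)
      fun x => ?_
    rw [← E.vectorMeasure_eq_quadForm x (measurableSet_box n hB), hE, hμ x n B hB]
  · refine POVM.ext_of_vectorMeasure fun x => Measure.ext_of_box fun n B hB => ?_
    rw [hE, hμ x n B hB, F.vectorMeasure_eq_quadForm x (measurableSet_box n hB),
      I.isInfiniteComposition_iff.1 hF n B hB]

/-! ### Conservation of the infinite composition -/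

/-- Under the identification of `Ω^ℕ` with `Ω × Ω^ℕ` by the first term and the shifted sequence, the
infinite composition is its own composition with the instrument. -/
theorem conserves_of_isInfiniteComposition {E : POVM H (ℕ → Ω)} (hE : I.IsInfiniteComposition E) :
    I.Conserves E := by
  let f : (ℕ → Ω) → Ω × (ℕ → Ω) := fun ω => (ω 0, fun k => ω (k + 1))
  let g : Ω × (ℕ → Ω) → ℕ → Ω := fun p k => Nat.casesOn k p.1 p.2
  have hf : Measurable f := (measurable_pi_apply 0).prodMk
    (measurable_pi_lambda _ fun k => measurable_pi_apply (k + 1))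
  have hg : Measurable g := measurable_pi_lambda _ fun k => by
    cases k with
    | zero => exact measurable_fst
    | succ k => exact (measurable_pi_apply k).comp measurable_snd
  have hgf : ∀ ω, g (f ω) = ω := fun ω => funext fun k => by cases k <;> rfl
  refine ⟨E.map f hf, fun B₁ B₂ h₁ h₂ => ?_, fuzzyLE_of_effect_eq_preimage hf fun B hB =>
    POVM.map_effect E hf hB, fuzzyLE_of_effect_eq_preimage hg fun B hB => ?_⟩
  · rw [POVM.map_effect E hf (h₁.prod h₂)]
    have hpom := I.isPositiveOperatorMeasure_op_comp E.isPositiveOperatorMeasure h₁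
    refine eq_of_quadForm_eq (E.effect_nonneg _ (hf (h₁.prod h₂))) (hpom.nonneg _ h₂) fun x => ?_
    obtain ⟨ρ, hρ⟩ := hpom.exists_measure x
    let σ := ((E.vectorMeasure x).restrict {ω | ω 0 ∈ B₁}).map fun ω k => ω (k + 1)
    have hσ : ∀ B, MeasurableSet B → σ B = (E.effect (f ⁻¹' B₁ ×ˢ B)).quadForm x := by
      intro B hB
      have hs : Measurable fun (ω : ℕ → Ω) k => ω (k + 1) := measurable_snd.comp hf
      rw [Measure.map_apply hs hB, Measure.restrict_apply (hs hB),
        ← E.vectorMeasure_eq_quadForm x (hf (h₁.prod hB))]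
      congr 1
      ext ω
      exact and_comm
    have : σ = ρ := Measure.ext_of_box fun n C hC => by
      have hC' : ∀ k, MeasurableSet (Nat.casesOn k B₁ C : Set Ω) := fun k => by
        cases k
        exacts [h₁, hC _]
      have hbox : f ⁻¹' B₁ ×ˢ box n C = box (n + 1) fun k => Nat.casesOn k B₁ C := by
        ext ω
        constructor
        · rintro ⟨h0, hs⟩ k hk
          cases k with
          | zero => exact h0
          | succ k => exact hs k (by omega)
        · exact fun h => ⟨h 0 (by omega), fun k hk => h (k + 1) (by omega)⟩
      rw [hσ _ (measurableSet_box n hC), hρ _ (measurableSet_box n hC), hbox,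
        I.isInfiniteComposition_iff.1 hE _ _ hC', I.isInfiniteComposition_iff.1 hE _ _ hC,
        opBox_succ']
      rfl
    rw [← hσ _ h₂, this, hρ _ h₂]
  · rw [POVM.map_effect E hf (hg hB), ← Set.preimage_comp,
      show g ∘ f = id from funext hgf, Set.preimage_id]

end CPInstrument

/-! ### Operator integrals of non-negative functions -/

/-- `E.IsLIntegral g T` says that the positive bounded operator `T` is `∫ g dE`, for a function `g`
with values in `[0, ∞]`. -/
def POVM.IsLIntegral {X : Type w} [MeasurableSpace X] (E : POVM H X) (g : X → ENNReal)
    (T : H →L[ℂ] H) : Prop :=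
  0 ≤ T ∧ ∀ x, T.quadForm x = ∫⁻ ω, g ω ∂E.vectorMeasure x

theorem POVM.isLIntegral_one {X : Type w} [MeasurableSpace X] (E : POVM H X) :
    E.IsLIntegral (fun _ => 1) 1 :=
  ⟨(nonneg_iff_isPositive _).2 isPositive_one, fun x => by
    rw [lintegral_one, E.vectorMeasure_eq_quadForm x .univ, E.effect_univ]⟩

namespace IsPositiveOperatorMeasure

variable {X : Type w} [MeasurableSpace X] {M : Set X → (H →L[ℂ] H)}

/-- The integral of a simple function against an operator measure (with `∞` replaced by `0`). -/
def simpleIntegral (M : Set X → (H →L[ℂ] H)) (s : SimpleFunc X ENNReal) : H →L[ℂ] H :=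
  ∑ r ∈ s.range, ((r.toReal : ℝ) : ℂ) • M (s ⁻¹' {r})

theorem simpleIntegral_nonneg (hM : IsPositiveOperatorMeasure M) (s : SimpleFunc X ENNReal) :
    0 ≤ simpleIntegral M s :=
  Finset.sum_nonneg fun r _ =>
    smul_nonneg_of_nonneg ENNReal.toReal_nonneg (hM.nonneg _ (s.measurableSet_fiber r))

theorem quadForm_simpleIntegral (hM : IsPositiveOperatorMeasure M) {s : SimpleFunc X ENNReal}
    (hs : ∀ ω, s ω ≠ ⊤) {x : H} {ρ : Measure X}
    (hρ : ∀ B, MeasurableSet B → ρ B = (M B).quadForm x) :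
    (simpleIntegral M s).quadForm x = s.lintegral ρ := by
  rw [simpleIntegral, quadForm_sum _ fun r _ =>
    smul_nonneg_of_nonneg ENNReal.toReal_nonneg (hM.nonneg _ (s.measurableSet_fiber r)),
    SimpleFunc.lintegral]
  refine Finset.sum_congr rfl fun r hr => ?_
  obtain ⟨ω, rfl⟩ := SimpleFunc.mem_range.1 hr
  rw [quadForm_smul ENNReal.toReal_nonneg, ENNReal.ofReal_toReal (hs ω),
    hρ _ (s.measurableSet_fiber _)]

end IsPositiveOperatorMeasure

namespace CPInstrument

open IsPositiveOperatorMeasure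

variable {Ω : Type v} [MeasurableSpace Ω] (I : CPInstrument H Ω)

theorem op_simpleIntegral {X : Type w} [MeasurableSpace X] (M : Set X → (H →L[ℂ] H)) (C : Set Ω)
    (s : SimpleFunc X ENNReal) :
    I.op C (simpleIntegral M s) = simpleIntegral (fun B => I.op C (M B)) s := by
  simp only [simpleIntegral, map_sum, map_smul]

/-- The defining property of the composition `G = I ∗ F`, extended from events to functions:
`I_C(∫ g dF) = ∫ 1_C(ω) g(x) G(dω, dx)`. Simple functions increasing to `g` reduce it to events,
since `I_C` is normal. -/
theorem isLIntegral_op {X : Type w} [MeasurableSpace X] {F : POVM H X} {G : POVM H (Ω × X)}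
    (hG : I.IsComposition F G) {C : Set Ω} (hC : MeasurableSet C) {g : X → ENNReal}
    (hg : Measurable g) {T : H →L[ℂ] H} (hT : F.IsLIntegral g T) :
    G.IsLIntegral (fun p => C.indicator 1 p.1 * g p.2) (I.op C T) := by
  refine ⟨I.op_nonneg C hT.1, fun x => ?_⟩
  let s := SimpleFunc.eapprox g
  have hs : ∀ n ω, s n ω ≠ ⊤ := fun n ω => (SimpleFunc.eapprox_lt_top g n ω).ne
  have hF := F.isPositiveOperatorMeasure
  have hIF := I.isPositiveOperatorMeasure_op_comp hF hC
  have hq : ∀ n y,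
      (simpleIntegral F.effect (s n)).quadForm y = (s n).lintegral (F.vectorMeasure y) :=
    fun n y => quadForm_simpleIntegral hF (hs n) fun _ hB => F.vectorMeasure_eq_quadForm y hB
  have hmono : ∀ μ : Measure X, Monotone fun n => (s n).lintegral μ := fun μ m n hmn =>
    SimpleFunc.lintegral_mono (SimpleFunc.monotone_eapprox g hmn) le_rfl
  have hlim : ∀ μ : Measure X, Tendsto (fun n => (s n).lintegral μ) atTop (𝓝 (∫⁻ ω, g ω ∂μ)) := by
    intro μ
    rw [lintegral_eq_iSup_eapprox_lintegral hg]
    exact tendsto_atTop_iSup (hmono μ)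
  have h := tendsto_quadForm_map_of_scottContinuous (I.op_normal C hC) (fun T => I.op_nonneg C)
    (A := fun n => simpleIntegral F.effect (s n)) (T := T) (fun n => simpleIntegral_nonneg hF (s n))
    (fun m n hmn => le_of_quadForm_le (simpleIntegral_nonneg hF _) (simpleIntegral_nonneg hF _)
      fun y => by rw [hq, hq]; exact hmono _ hmn)
    hT.1 (fun y => by simp only [hq, hT.2 y]; exact hlim _) x
  let σ := ((G.vectorMeasure x).restrict (C ×ˢ Set.univ)).map Prod.snd
  have hσ : ∀ B, MeasurableSet B → σ B = (I.op C (F.effect B)).quadForm x := by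
    intro B hB
    rw [Measure.map_apply measurable_snd hB, Measure.restrict_apply (measurable_snd hB),
      ← hG C B hC hB, ← G.vectorMeasure_eq_quadForm x (hC.prod hB)]
    congr 1
    ext p
    simp [and_comm]
  simp only [op_simpleIntegral, fun n => quadForm_simpleIntegral hIF (hs n) hσ] at h
  rw [tendsto_nhds_unique h (hlim σ), lintegral_map hg measurable_snd,
    ← lintegral_indicator (hC.prod .univ)]
  refine lintegral_congr fun p => ?_
  by_cases hp : p.1 ∈ C <;> simp [Set.indicator, hp]

end CPInstrument

theorem POVM.IsLIntegral.of_bind {X : Type v} {Y : Type w} [MeasurableSpace X] [MeasurableSpace Y]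
    {F : POVM H X} {G : POVM H Y} {ν : Kernel X Y}
    (h : ∀ x, G.vectorMeasure x = (F.vectorMeasure x).bind ν) {g : Y → ENNReal} (hg : Measurable g)
    {T : H →L[ℂ] H} (hT : G.IsLIntegral g T) : F.IsLIntegral (fun ω => ∫⁻ p, g p ∂ν ω) T :=
  ⟨hT.1, fun x => by rw [hT.2, h, Measure.lintegral_bind ν.aemeasurable hg.aemeasurable]⟩

/-! ### The Markov chain of repeated measurements -/

section Chain

open Finset Preorder

variable {Ω : Type v} {X : Type w} [MeasurableSpace Ω] [MeasurableSpace X]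

/-- The transition kernels, in the format of the Ionescu-Tulcea theorem, of the chain of pairs
`(ω, x)` in which the next pair is drawn from `ν x`. -/
def stepKernel (ν : Kernel X (Ω × X)) (n : ℕ) : Kernel (Π _ : Iic n, Ω × X) (Ω × X) :=
  ν.comap (fun h => (h ⟨n, mem_Iic.2 le_rfl⟩).2) (measurable_snd.comp (measurable_pi_apply _))

instance (ν : Kernel X (Ω × X)) [IsMarkovKernel ν] (n : ℕ) : IsMarkovKernel (stepKernel ν n) := by
  unfold stepKernel; infer_instance

/-- The law of the chain `(ω₀, x₀), (ω₁, x₁), …` started by drawing `(ω₀, x₀)` from `ν x`. -/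
def chain (ν : Kernel X (Ω × X)) [IsMarkovKernel ν] : Kernel X (ℕ → Ω × X) :=
  Kernel.traj (X := fun _ => Ω × X) (stepKernel ν) 0 ∘ₖ
    ν.map (MeasurableEquiv.piUnique fun _ : Iic 0 => Ω × X).symm

variable (ν : Kernel X (Ω × X)) [IsMarkovKernel ν]

theorem chain_apply (x : X) :
    chain ν x = Kernel.trajMeasure (X := fun _ => Ω × X) (ν x) (stepKernel ν) := by
  rw [chain, Kernel.comp_apply, Kernel.map_apply _ (MeasurableEquiv.measurable _)]
  rfl

instance : IsMarkovKernel (chain ν) :=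
  ⟨fun x => by rw [chain_apply]; infer_instance⟩

theorem chain_map_zero (x : X) : (chain ν x).map (fun z => z 0) = ν x := by
  have h : (chain ν).map (frestrictLe (π := fun _ => Ω × X) 0) =
      ν.map (MeasurableEquiv.piUnique fun _ : Iic 0 => Ω × X).symm := by
    rw [chain, Kernel.map_comp, Kernel.traj_map_frestrictLe, Kernel.partialTraj_self,
      Kernel.id_comp]
  let e := MeasurableEquiv.piUnique fun _ : Iic 0 => Ω × X
  have he : e ∘ frestrictLe (π := fun _ => Ω × X) 0 = fun z => z 0 := rfl
  calc (chain ν x).map (fun z => z 0)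
      = ((chain ν x).map (frestrictLe (π := fun _ => Ω × X) 0)).map e := by
        rw [← he]
        exact (Measure.map_map e.measurable (measurable_frestrictLe 0)).symm
    _ = ν x := by
        rw [← Kernel.map_apply _ (measurable_frestrictLe _), h,
          Kernel.map_apply _ e.symm.measurable, Measure.map_map e.measurable e.symm.measurable,
          MeasurableEquiv.self_comp_symm,
          Measure.map_id]

/-- Integrating out the last step of the chain, by the Markov property. -/
theorem lintegral_chain_succ (x : X) (n : ℕ) {a : (Π _ : Iic n, Ω × X) → ENNReal}
    (ha : Measurable a) {g : Ω × X → ENNReal} (hg : Measurable g) :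
    ∫⁻ z, a (frestrictLe n z) * g (z (n + 1)) ∂chain ν x =
      ∫⁻ z, a (frestrictLe n z) * ∫⁻ p, g p ∂ν (z n).2 ∂chain ν x := by
  have h := Kernel.map_frestrictLe_trajMeasure_compProd_eq_map_trajMeasure
    (X := fun _ => Ω × X) (μ₀ := ν x) (κ := stepKernel ν) (a := n)
  rw [← chain_apply] at h
  have hφ : Measurable fun q : (Π _ : Iic n, Ω × X) × (Ω × X) => a q.1 * g q.2 := by fun_prop
  have hpair : Measurable fun z : ℕ → Ω × X => (frestrictLe (π := fun _ => Ω × X) n z, z (n + 1)) :=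
    by fun_prop
  calc ∫⁻ z, a (frestrictLe n z) * g (z (n + 1)) ∂chain ν x
      = ∫⁻ q, a q.1 * g q.2 ∂((chain ν x).map fun z => (frestrictLe n z, z (n + 1))) :=
        (lintegral_map hφ hpair).symm
    _ = ∫⁻ y, ∫⁻ p, a y * g p ∂stepKernel ν n y ∂((chain ν x).map (frestrictLe n)) := by
        rw [← h, Measure.lintegral_compProd hφ]
    _ = ∫⁻ y, a y * ∫⁻ p, g p ∂stepKernel ν n y ∂((chain ν x).map (frestrictLe n)) :=
        lintegral_congr fun y => lintegral_const_mul _ hg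
    _ = _ := lintegral_map (ha.mul hg.lintegral_kernel) (measurable_frestrictLe n)

end Chain

namespace CPInstrument

variable {Ω : Type v} [MeasurableSpace Ω] (I : CPInstrument H Ω)

/-- If `ν` reproduces the composition `G = I ∗ F` from `F`, the first outcomes of its Markov chain
and the last state are distributed according to the composed operations. -/
theorem isLIntegral_opBox {X : Type w} [MeasurableSpace X] {F : POVM H X} {G : POVM H (Ω × X)}
    (hG : I.IsComposition F G) {ν : Kernel X (Ω × X)} [IsMarkovKernel ν]
    (hν : ∀ x, G.vectorMeasure x = (F.vectorMeasure x).bind ν) (n : ℕ) {B : ℕ → Set Ω}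
    (hB : ∀ k, MeasurableSet (B k)) {g : X → ENNReal} (hg : Measurable g) {T : H →L[ℂ] H}
    (hT : F.IsLIntegral g T) :
    F.IsLIntegral (fun x => ∫⁻ z, (box (n + 1) B).indicator 1 (fun k => (z k).1) * g (z n).2
      ∂chain ν x) (I.opBox (n + 1) B T) := by
  have hstep : ∀ m, Measurable fun p : Ω × X => (B m).indicator (1 : Ω → ENNReal) p.1 * g p.2 :=
    fun m => ((measurable_one.indicator (hB m)).comp measurable_fst).mul (hg.comp measurable_snd)
  induction n generalizing g T with
  | zero =>
    have h := (I.isLIntegral_op hG (hB 0) hg hT).of_bind hν (hstep 0)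
    rw [opBox_succ, opBox_zero]
    convert h using 2 with x
    rw [← chain_map_zero ν x, lintegral_map (hstep 0) (measurable_pi_apply 0)]
    refine lintegral_congr fun z => ?_
    have hz : (fun k => (z k).1) ∈ box (0 + 1) B ↔ (z 0).1 ∈ B 0 := by
      rw [box_succ, box_zero, Set.univ_inter]
      rfl
    by_cases h0 : (z 0).1 ∈ B 0
    · rw [Set.indicator_of_mem (hz.2 h0), Set.indicator_of_mem h0]
      rfl
    · rw [Set.indicator_of_notMem fun h => h0 (hz.1 h), Set.indicator_of_notMem h0]
  | succ n ih =>
    have h := (I.isLIntegral_op hG (hB (n + 1)) hg hT).of_bind hν (hstep (n + 1))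
    have hg' : Measurable fun x =>
        ∫⁻ p, (B (n + 1)).indicator 1 p.1 * g p.2 ∂ν x := (hstep (n + 1)).lintegral_kernel
    have h' := ih hg' h fun m => ((measurable_one.indicator (hB m)).comp measurable_fst).mul
      (hg'.comp measurable_snd)
    rw [opBox_succ]
    convert h' using 2 with x
    let a : (Π _ : Finset.Iic n, Ω × X) → ENNReal :=
      Set.indicator {y | ∀ k (hk : k < n + 1), (y ⟨k, Finset.mem_Iic.2 (by omega)⟩).1 ∈ B k} 1
    have ha : Measurable a := by
      refine measurable_one.indicator ?_
      simp only [Set.ofPred_forall]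
      exact .iInter fun k => .iInter fun hk =>
        (measurable_fst.comp (measurable_pi_apply _)) (hB k)
    have haz : ∀ z : ℕ → Ω × X, a (Preorder.frestrictLe n z) =
        (box (n + 1) B).indicator 1 fun k => (z k).1 := fun z => rfl
    have := lintegral_chain_succ ν x n ha (hstep (n + 1))
    simp only [haz] at this
    rw [← this]
    refine lintegral_congr fun z => ?_
    rw [← mul_assoc]
    congr 1
    rw [box_succ _ B]
    by_cases h1 : (fun k => (z k).1) ∈ box (n + 1) B <;> by_cases h2 : (z (n + 1)).1 ∈ B (n + 1) <;>
      simp [Set.indicator, h1, h2]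

/-- The infinite composition is fuzzier than every conserved POVM `F`: the outcomes of the chain of
a kernel that reproduces `I ∗ F` from `F` reproduce the infinite composition from `F`. -/
theorem fuzzyLE_of_conserves {E : POVM H (ℕ → Ω)} (hE : I.IsInfiniteComposition E)
    {X : Type w} [MeasurableSpace X] {F : POVM H X} (hF : I.Conserves F) : FuzzyLE E F := by
  obtain ⟨G, hG, hGF, -⟩ := hF
  obtain ⟨ν, hνM, hν⟩ := fuzzyLE_iff.1 hGF
  have hfst : Measurable fun (z : ℕ → Ω × X) k => (z k).1 :=
    measurable_pi_lambda _ fun k => measurable_fst.comp (measurable_pi_apply k)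
  refine fuzzyLE_iff.2 ⟨(chain ν).map fun z k => (z k).1, Kernel.IsMarkovKernel.map _ hfst,
    fun x => Measure.ext_of_box fun n B hB => ?_⟩
  have hpos : ∀ n (B : ℕ → Set Ω), (∀ k, MeasurableSet (B k)) →
      E.vectorMeasure x (box (n + 1) B) =
        (F.vectorMeasure x).bind ((chain ν).map fun z k => (z k).1) (box (n + 1) B) := by
    intro n B hB
    have hm := measurableSet_box (n + 1) hB
    rw [E.vectorMeasure_eq_quadForm x hm, I.isInfiniteComposition_iff.1 hE _ B hB,
      (I.isLIntegral_opBox hG hν n hB measurable_const F.isLIntegral_one).2 x,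
      Measure.bind_apply hm (Kernel.aemeasurable _)]
    refine lintegral_congr fun ω => ?_
    rw [Kernel.map_apply' _ hfst _ hm, ← lintegral_indicator_one (hfst hm)]
    exact lintegral_congr fun z => mul_one _
  cases n with
  -- The box without sides is the box with the single side `Set.univ`.
  | zero => simpa [box] using hpos 0 (fun _ => Set.univ) fun _ => .univ
  | succ n => exact hpos n B hB

end CPInstrument

end

theorem theorem4 {H : Type u} [NormedAddCommGroup H] [InnerProductSpace ℂ H] [CompleteSpace H]
    {Ω : Type v} [MeasurableSpace Ω] [StandardBorelSpace Ω] (I : CPInstrument H Ω) :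
    (∃! E : POVM H (ℕ → Ω), I.IsInfiniteComposition E) ∧
      ∀ E : POVM H (ℕ → Ω), I.IsInfiniteComposition E →
        I.Conserves E ∧
          ∀ (X : Type w) [MeasurableSpace X] [StandardBorelSpace X] (F : POVM H X),
            I.Conserves F → FuzzyLE E F :=
  ⟨I.existsUnique_infiniteComposition, fun _ hE => ⟨I.conserves_of_isInfiniteComposition hE,
    fun _ _ _ _ hF => I.fuzzyLE_of_conserves hE hF⟩⟩
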